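/- **Riccati upper bounds.** Let $A\in\mathbb R^{n\times n}$, $B\in\mathbb R^{n\times p}$. Write $\mathcal C_k=[\,B\;\,AB\;\cdots\;A^{k-1}B\,]$ (with $\operatorname{rank}\mathcal C_0=0$). The pair $(A,B)$ is controllable if $\operatorname{rank}\mathcal C_k=n$ for some $k\le n$; its controllability index is $\kappa=\min\{k\ge 1:\operatorname{rank}\mathcal C_k=n\}$. Put $p_i=\operatorname{rank}\mathcal C_i-\operatorname{rank}\mathcal C_{i-1}$ for $1\le i\le\kappa$. A staircase form of a controllable pair is given by an orthogonal $U$ such that, in the partition of $\{1,\dots,n\}$ into consecutive blocks of sizes $p_1,\dots,p_\kappa$, only the first block $B_1$ of rows of $U'B$ is nonzero, and the blocks $A_{i,j}$ of $U'AU$ vanish for $i\ge j+2$ and have full row rank $p_{i}$ for $i=j+1$. For $\mu>0$ the pair is $\mu$-robustly coupled if it is controllable and, in a staircase form, $\sigma_p(B_1)\ge\mu$ and $\sigma_{p_{i+1}}(A_{i+1,i})\ge\mu$ for $1\le i\le\kappa-1$, where $\sigma_k$ is the $k$-th largest singular value. All norms are spectral norms. For every $c>1$ there is a real polynomial $F$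 in five variables, depending only on $c$, such that the following holds for all $n,p$, all $M\ge 1$, $\mu>0$, every controllable and $\mu$-robustly coupled pair $(A,B)$ with controllability index $\kappa$ and $\|A\|_2,\|B\|_2\le M$, every positive semidefinite $Q\in\mathbb R^{n\times n}$ and every positive definite $R\in\mathbb R^{p\times p}$. (1) If $\max\{M,M/\mu\}\ge c$, then for every $T>\kappa$ the solution of the Riccati difference equation $$P_{k-1}=A'P_kA+Q-A'P_kB(B'P_kB+R)^{-1}B'P_kA,\qquad P_T=Q,$$ satisfies $$\|P_0\|_2\le F\big((M/\mu)^{\kappa},\,M^{\kappa},\,\kappa,\,\|Q\|_2,\,\|R\|_2\big).$$ Moreover, if $Q\succ 0$, then the algebraic Riccati equation $$P=A'PA+Q-A'PB(B'PB+R)^{-1}B'PA$$ has a unique positive definite solution $P$, and $\|P\|_2$ satisfies the same bound. (2) Without the condition $\max\{M,M/\mu\}\ge c$, the same statements hold with the bound $$F\big((cM/\mu)^{\kappa},\,M^{\kappa},\,\kappa,\,\|Q\|_2,\,\|R\|_2\big).$$ -/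

import Mathlib

open scoped Matrix Matrix.Norms.L2Operator

noncomputable section

/-- The controllability matrix `[B, A B, …, A ^ (k - 1) B]`; its columns are indexed by pairs
(block number, column of `B`). -/
def controllabilityMatrix {n p : ℕ} (A : Matrix (Fin n) (Fin n) ℝ) (B : Matrix (Fin n) (Fin p) ℝ)
    (k : ℕ) : Matrix (Fin n) (Fin k × Fin p) ℝ :=
  Matrix.of fun i jc => (A ^ (jc.1 : ℕ) * B) i jc.2

/-- The rank of the controllability matrix with `k` blocks (`0` for `k = 0`). -/
def ctrbRank {n p : ℕ} (A : Matrix (Fin n) (Fin n) ℝ) (B : Matrix (Fin n) (Fin p) ℝ) (k : ℕ) : ℕ :=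
  (controllabilityMatrix A B k).rank

/-- `(A, B)` is controllable. -/
def IsControllablePair {n p : ℕ} (A : Matrix (Fin n) (Fin n) ℝ) (B : Matrix (Fin n) (Fin p) ℝ) :
    Prop :=
  ∃ k ≤ n, ctrbRank A B k = n

/-- The controllability index: the least `k ≥ 1` such that the controllability matrix with `k`
blocks has rank `n`. -/
def controllabilityIndex {n p : ℕ} (A : Matrix (Fin n) (Fin n) ℝ)
    (B : Matrix (Fin n) (Fin p) ℝ) : ℕ :=
  sInf {k : ℕ | 1 ≤ k ∧ ctrbRank A B k = n}

/-- Coordinate `r` belongs to the `i`-th block of the staircase partition (`i = 1, …, κ`). The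
`i`-th block consists of `p_i = rank C_i - rank C_{i-1}` consecutive coordinates. -/
abbrev InStairBlock {n p : ℕ} (A : Matrix (Fin n) (Fin n) ℝ) (B : Matrix (Fin n) (Fin p) ℝ)
    (i : ℕ) (r : Fin n) : Prop :=
  ctrbRank A B (i - 1) ≤ (r : ℕ) ∧ (r : ℕ) < ctrbRank A B i

/-- The size `p_i` of the `i`-th block. -/
def stairSize {n p : ℕ} (A : Matrix (Fin n) (Fin n) ℝ) (B : Matrix (Fin n) (Fin p) ℝ)
    (i : ℕ) : ℕ :=
  ctrbRank A B i - ctrbRank A B (i - 1)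

/-- The block `A_{i,j}` of `Uᵀ A U` in the staircase partition. -/
def stairBlockA {n p : ℕ} (A : Matrix (Fin n) (Fin n) ℝ) (B : Matrix (Fin n) (Fin p) ℝ)
    (U : Matrix (Fin n) (Fin n) ℝ) (i j : ℕ) :
    Matrix {r : Fin n // InStairBlock A B i r} {r : Fin n // InStairBlock A B j r} ℝ :=
  (Uᵀ * A * U).toBlock (InStairBlock A B i) (InStairBlock A B j)

/-- The `i`-th block of rows of `Uᵀ B` in the staircase partition; the first one is `B_1`. -/
def stairBlockB {n p : ℕ} (A : Matrix (Fin n) (Fin n) ℝ) (B : Matrix (Fin n) (Fin p) ℝ)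
    (U : Matrix (Fin n) (Fin n) ℝ) (i : ℕ) :
    Matrix {r : Fin n // InStairBlock A B i r} (Fin p) ℝ :=
  (Uᵀ * B).submatrix Subtype.val id

/-- The orthogonal matrix `U` brings `(A, B)` to staircase (block Hessenberg) form: only the first
block of `Uᵀ B` is nonzero, the blocks of `Uᵀ A U` below the first block subdiagonal vanish, and
the subdiagonal blocks have full row rank. -/
structure IsStaircaseTransform {n p : ℕ} (A : Matrix (Fin n) (Fin n) ℝ)
    (B : Matrix (Fin n) (Fin p) ℝ) (U : Matrix (Fin n) (Fin n) ℝ) : Prop where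
  orthogonal : U ∈ Matrix.orthogonalGroup (Fin n) ℝ
  inputBlocks : ∀ i, 2 ≤ i → stairBlockB A B U i = 0
  lowerBlocks : ∀ i j, j + 2 ≤ i → stairBlockA A B U i j = 0
  fullRowRank : ∀ i, 1 ≤ i → i + 1 ≤ controllabilityIndex A B →
    (stairBlockA A B U (i + 1) i).rank = stairSize A B (i + 1)

/-- The `k`-th largest singular value (`k = 1, 2, …`) of a real matrix. -/
def singularValue {m l : Type*} [Fintype m] [Fintype l] [DecidableEq l] (X : Matrix m l ℝ)
    (k : ℕ) : ℝ :=
  (Matrix.toEuclideanLin X).singularValues (k - 1)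

/-- `(A, B)` is `μ`-robustly coupled. The singular values that occur do not depend on the choice
of the staircase form. The condition on `B_1` forces `B` to have full column rank, so that `B_1`
is a square matrix. -/
def IsRobustlyCoupled {n p : ℕ} (A : Matrix (Fin n) (Fin n) ℝ) (B : Matrix (Fin n) (Fin p) ℝ)
    (μ : ℝ) : Prop :=
  0 < μ ∧ IsControllablePair A B ∧ ∃ U, IsStaircaseTransform A B U ∧
    μ ≤ singularValue (stairBlockB A B U 1) p ∧
    ∀ i, 1 ≤ i → i + 1 ≤ controllabilityIndex A B →
      μ ≤ singularValue (stairBlockA A B U (i + 1) i) (stairSize A B (i + 1))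

/-- The right-hand side of the Riccati equation. -/
def riccatiMap {n p : ℕ} (A : Matrix (Fin n) (Fin n) ℝ) (B : Matrix (Fin n) (Fin p) ℝ)
    (Q : Matrix (Fin n) (Fin n) ℝ) (R : Matrix (Fin p) (Fin p) ℝ)
    (P : Matrix (Fin n) (Fin n) ℝ) : Matrix (Fin n) (Fin n) ℝ :=
  Aᵀ * P * A + Q - Aᵀ * P * B * (Bᵀ * P * B + R)⁻¹ * Bᵀ * P * A

/-- `P_0, …, P_T` solves the Riccati difference equation with terminal condition `P_T = Q`. -/
def IsRiccatiDifferenceSolution {n p : ℕ} (A : Matrix (Fin n) (Fin n) ℝ)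
    (B : Matrix (Fin n) (Fin p) ℝ) (Q : Matrix (Fin n) (Fin n) ℝ) (R : Matrix (Fin p) (Fin p) ℝ)
    (T : ℕ) (P : ℕ → Matrix (Fin n) (Fin n) ℝ) : Prop :=
  P T = Q ∧ ∀ k, 1 ≤ k → k ≤ T → P (k - 1) = riccatiMap A B Q R (P k)

/-- `P` is a positive definite solution of the algebraic Riccati equation. -/
def IsPosDefRiccatiSolution {n p : ℕ} (A : Matrix (Fin n) (Fin n) ℝ)
    (B : Matrix (Fin n) (Fin p) ℝ) (Q : Matrix (Fin n) (Fin n) ℝ) (R : Matrix (Fin p) (Fin p) ℝ)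
    (P : Matrix (Fin n) (Fin n) ℝ) : Prop :=
  P.PosDef ∧ P = riccatiMap A B Q R P

/-- Both Riccati matrices are bounded by `b` in the spectral norm: `P_0` for every horizon `T > κ`
and, if `Q` is positive definite, the (existing and unique) positive definite solution of the
algebraic Riccati equation. -/
def RiccatiBoundedBy {n p : ℕ} (A : Matrix (Fin n) (Fin n) ℝ) (B : Matrix (Fin n) (Fin p) ℝ)
    (Q : Matrix (Fin n) (Fin n) ℝ) (R : Matrix (Fin p) (Fin p) ℝ) (κ : ℕ) (b : ℝ) : Prop :=
  (∀ T : ℕ, κ < T → ∀ P : ℕ → Matrix (Fin n) (Fin n) ℝ,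
      IsRiccatiDifferenceSolution A B Q R T P → ‖P 0‖ ≤ b) ∧
  (Q.PosDef → ∃ P : Matrix (Fin n) (Fin n) ℝ, IsPosDefRiccatiSolution A B Q R P ∧
      (∀ P', IsPosDefRiccatiSolution A B Q R P' → P' = P) ∧ ‖P‖ ≤ b)

end

open scoped Matrix Matrix.Norms.L2Operator
open Filter Topology

/-! The Riccati iterate of horizon `t` is the optimal value of a quadratic regulator problem, so its
quadratic form at `x₀` is at most the cost of any control sequence (`iterate_riccatiMap_le_cost`).
It therefore suffices to steer `x₀` to the origin in `κ` steps and to keep states and inputs within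
a factor exponential in `κ`; zero input afterwards costs nothing, so the bound does not depend on
the horizon.

The steering comes from new coordinates `T i` adapted to the staircase. They are built backwards
from the last block so that `T (i + 1) (A x)` is the block of `A (T i x)` just below block `i`.
Inputs enter only through `T 0`, so a feedback that cancels `T 0 (A x)` empties the chain one
coordinate per step. The rows are bounded by powers of `3 * (M / μ)`. To recover the state, the
triangular coordinate change is not inverted: the dynamics express a tail of `x k` through shorter
tails of `x k` and `x (k + 1)` (`norm_state_le`), which costs a factor `5 * (M / μ)` per block.
Right inverses of norm at most `1 / μ` come from the singular value hypotheses.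

For the algebraic equation, the iterates started at `Q` increase and are bounded, hence converge to
a fixed point above `Q`. Uniqueness holds because the closed loop of one solution has finite total
cost, so the terminal cost measured by another solution tends to zero.

The remaining constant `2025 ^ κ` is at most a fixed power of `c ^ κ`, and the hypothesis on `c`, or
the factor `c` in the bound, absorbs it into the polynomial. -/

/-! ### Deadbeat control of an abstract staircase system -/

/-- The linear system `x ↦ A x + B u` is in staircase form with respect to the decreasing family of
projections `g i`, with right inverses `N i` of the subdiagonal blocks and `K` of the input block,
all bounded by `1 / μ`. -/
structure HasStaircaseForm {E P : Type*} [NormedAddCommGroup E] [NormedSpace ℝ E]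
    [NormedAddCommGroup P] [NormedSpace ℝ P] (A : E →ₗ[ℝ] E) (B : P →ₗ[ℝ] E)
    (g N : ℕ → E →ₗ[ℝ] E) (K : E →ₗ[ℝ] P) (κ : ℕ) (M μ : ℝ) : Prop where
  one_le_index : 1 ≤ κ
  one_le_bound : 1 ≤ M
  coupling_pos : 0 < μ
  coupling_le : μ ≤ M
  norm_A : ∀ x, ‖A x‖ ≤ M * ‖x‖
  norm_g : ∀ i x, ‖g i x‖ ≤ ‖x‖
  norm_block : ∀ i x, ‖g i x - g (i + 1) x‖ ≤ ‖x‖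
  -- Blocks are counted from zero: `g i` discards the first `i` blocks, block `i` is the range of `g
  -- i - g (i + 1)`, and `N i` lifts block `i + 1` to block `i`.
  g_comp : ∀ i j x, g i (g j x) = g (max i j) x
  g_zero : ∀ x, g 0 x = x
  g_index : ∀ x, g κ x = 0
  g_A : ∀ i x, g (i + 1) (A (g i x)) = g (i + 1) (A x)
  g_B : ∀ u, g 1 (B u) = 0
  norm_N : ∀ i, i + 1 < κ → ∀ y, ‖N i y‖ ≤ ‖y‖ / μ
  g_N : ∀ i, i + 1 < κ → ∀ y, g i (N i y) = N i y
  g_succ_N : ∀ i, i + 1 < κ → ∀ y, g (i + 1) (N i y) = 0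
  N_block : ∀ i, i + 1 < κ → ∀ y, N i (g (i + 1) y - g (i + 2) y) = N i y
  block_A_N : ∀ i, i + 1 < κ → ∀ y,
    g (i + 1) (A (N i y)) - g (i + 2) (A (N i y)) = g (i + 1) y - g (i + 2) y
  norm_K : ∀ y, ‖K y‖ ≤ ‖y‖ / μ
  B_K : ∀ y, B (K y) = y - g 1 y

/-- The rows of the coordinate change that turns a staircase form into a chain of blocks, counted
from the last block. -/
def backstep {E : Type*} [NormedAddCommGroup E] [NormedSpace ℝ E] (A : E →ₗ[ℝ] E)
    (g N : ℕ → E →ₗ[ℝ] E) (κ : ℕ) : ℕ → E →ₗ[ℝ] E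
  | 0 => g (κ - 1)
  | j + 1 => (g (κ - 2 - j) - g (κ - 2 - j + 1))
      - (N (κ - 2 - j)).comp (A.comp (g (κ - 2 - j) - g (κ - 2 - j + 1)))
      + (N (κ - 2 - j)).comp ((backstep A g N κ j).comp A)

namespace HasStaircaseForm

variable {E P : Type*} [NormedAddCommGroup E] [NormedSpace ℝ E] [NormedAddCommGroup P]
  [NormedSpace ℝ P] {A : E →ₗ[ℝ] E} {B : P →ₗ[ℝ] E} {g N : ℕ → E →ₗ[ℝ] E} {K : E →ₗ[ℝ] P}
  {κ : ℕ} {M μ : ℝ}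

theorem one_le_ratio (h : HasStaircaseForm A B g N K κ M μ) : 1 ≤ M / μ := by
  rw [le_div_iff₀ h.coupling_pos, one_mul]
  exact h.coupling_le

/-- Reindexes `backstep` by the block itself. In the recursion the last term creates the chain
relation of `row_succ_A`, and the middle term keeps the diagonal of the coordinate change equal to
the identity. -/
theorem exists_chain (_h : HasStaircaseForm A B g N K κ M μ) :
    ∃ T : ℕ → E →ₗ[ℝ] E, T (κ - 1) = g (κ - 1) ∧
      ∀ i, i + 1 < κ → ∀ x, T i x = (g i x - g (i + 1) x) - N i (A (g i x - g (i + 1) x))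
        + N i (T (i + 1) (A x)) := by
  refine ⟨fun i => backstep A g N κ (κ - 1 - i), by simp [backstep], fun i hi x => ?_⟩
  obtain ⟨j, hj⟩ : ∃ j, κ = i + j + 2 := ⟨κ - i - 2, by omega⟩
  have h1 : κ - 1 - i = j + 1 := by omega
  have h2 : κ - 1 - (i + 1) = j := by omega
  have h3 : κ - 2 - j = i := by omega
  simp only [h1, h2, backstep, h3]
  simp

theorem g_self (h : HasStaircaseForm A B g N K κ M μ) (i : ℕ) (x : E) :
    g i (g i x) = g i x := by
  rw [h.g_comp, max_self]

theorem g_g_succ (h : HasStaircaseForm A B g N K κ M μ) (i : ℕ) (x : E) :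
    g i (g (i + 1) x) = g (i + 1) x := by
  rw [h.g_comp, max_eq_right (Nat.le_succ i)]

theorem g_succ_g (h : HasStaircaseForm A B g N K κ M μ) (i : ℕ) (x : E) :
    g (i + 1) (g i x) = g (i + 1) x := by
  rw [h.g_comp, max_eq_left (Nat.le_succ i)]

/-- Row `i` of the coordinate change is the identity on block `i`, vanishes on the blocks before
it, and takes values in block `i`. -/
structure IsBlockRow (g : ℕ → E →ₗ[ℝ] E) (T : E →ₗ[ℝ] E) (i : ℕ) : Prop where
  apply_g : ∀ x, T (g i x) = T x
  g_apply : ∀ x, g i (T x) = T x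
  g_succ_apply : ∀ x, g (i + 1) (T x) = 0
  apply_block : ∀ x, T (g i x - g (i + 1) x) = g i x - g (i + 1) x

/-- Downward induction from the last block. Since `A` lowers the staircase by at most one block, row
`i + 1` composed with `A` sees only the tail `g i x`. -/
theorem isBlockRow (h : HasStaircaseForm A B g N K κ M μ) {T : ℕ → E →ₗ[ℝ] E}
    (hT : T (κ - 1) = g (κ - 1))
    (hT' : ∀ i, i + 1 < κ → ∀ x, T i x = (g i x - g (i + 1) x)
      - N i (A (g i x - g (i + 1) x)) + N i (T (i + 1) (A x)))
    (j : ℕ) : ∀ i, i + j + 1 = κ → IsBlockRow g (T i) i := by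
  induction j with
  | zero =>
    intro i hi
    obtain rfl : i = κ - 1 := by omega
    have h1 : κ - 1 + 1 = κ := by omega
    constructor <;> intro x
    · rw [hT, h.g_self]
    · rw [hT, h.g_self]
    · rw [hT, h1, h.g_index]
    · rw [hT, map_sub, h.g_self, h.g_g_succ]
  | succ j ih =>
    intro i hi
    have hi' : i + 1 < κ := by omega
    have H := ih (i + 1) (by omega)
    constructor <;> intro x
    · rw [hT' i hi', hT' i hi', h.g_self, h.g_succ_g, ← H.apply_g (A (g i x)), h.g_A, H.apply_g]
    · rw [hT' i hi']
      simp only [map_add, map_sub, h.g_self, h.g_g_succ, h.g_N i hi']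
    · rw [hT' i hi']
      simp only [map_add, map_sub, h.g_self, h.g_succ_g, h.g_succ_N i hi']
      simp
    -- For `y` in block `i`, `A y` has no part beyond block `i + 1`, where row `i + 1` is already
    -- the identity, so the two correction terms of row `i` cancel on `y`.
    · set y := g i x - g (i + 1) x with hy
      have e1 : g i y = y := by rw [hy, map_sub, h.g_self, h.g_g_succ]
      have e2 : g (i + 1) y = 0 := by rw [hy, map_sub, h.g_self, h.g_succ_g, sub_self]
      have e3 : g (i + 2) (A y) = 0 := by
        rw [← h.g_A (i + 1), e2, map_zero, map_zero]
      have e4 := H.apply_block (A y)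
      rw [e3, sub_zero, H.apply_g] at e4
      have e5 := h.N_block i hi' (A y)
      rw [e3, sub_zero] at e5
      rw [hT' i hi', e1, e2, sub_zero, e4, e5, sub_add_cancel]

/-- Each of the three terms of the recursion costs at most a factor `M / μ` over the bound for the
next row, which gives the 3. -/
theorem norm_row_le (h : HasStaircaseForm A B g N K κ M μ) {T : ℕ → E →ₗ[ℝ] E}
    (hT : T (κ - 1) = g (κ - 1))
    (hT' : ∀ i, i + 1 < κ → ∀ x, T i x = (g i x - g (i + 1) x)
      - N i (A (g i x - g (i + 1) x)) + N i (T (i + 1) (A x)))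
    (j : ℕ) : ∀ i, i + j + 1 = κ → ∀ x, ‖T i x‖ ≤ (3 * (M / μ)) ^ j * ‖x‖ := by
  have hr := h.one_le_ratio
  have hμ := h.coupling_pos
  induction j with
  | zero =>
    intro i hi x
    obtain rfl : i = κ - 1 := by omega
    rw [hT, pow_zero, one_mul]
    exact h.norm_g _ x
  | succ j ih =>
    intro i hi x
    have hi' : i + 1 < κ := by omega
    set y := g i x - g (i + 1) x with hy
    have h1 : ‖y‖ ≤ ‖x‖ := h.norm_block i x
    have h2 : ‖N i (A y)‖ ≤ M / μ * ‖x‖ := by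
      refine (h.norm_N i hi' _).trans ?_
      rw [div_mul_eq_mul_div]
      have := (h.norm_A y).trans
        (mul_le_mul_of_nonneg_left h1 (zero_le_one.trans h.one_le_bound))
      gcongr
    have h3 : ‖N i (T (i + 1) (A x))‖ ≤ M / μ * ((3 * (M / μ)) ^ j * ‖x‖) := by
      refine (h.norm_N i hi' _).trans ?_
      rw [div_mul_eq_mul_div]
      have h4 := ih (i + 1) (by omega) (A x)
      have h5 := mul_le_mul_of_nonneg_left (h.norm_A x)
        (show (0 : ℝ) ≤ (3 * (M / μ)) ^ j by positivity)
      gcongr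
      linarith
    rw [hT' i hi', ← hy]
    have h6 : ‖x‖ ≤ M / μ * ((3 * (M / μ)) ^ j * ‖x‖) := by
      have : 1 ≤ M / μ * (3 * (M / μ)) ^ j :=
        one_le_mul_of_one_le_of_one_le hr (one_le_pow₀ (by linarith))
      nlinarith [norm_nonneg x]
    have h7 : M / μ * ‖x‖ ≤ M / μ * ((3 * (M / μ)) ^ j * ‖x‖) := by
      have : 1 ≤ (3 * (M / μ)) ^ j := one_le_pow₀ (by linarith)
      gcongr
      nlinarith [norm_nonneg x]
    calc _ ≤ ‖y‖ + ‖N i (A y)‖ + ‖N i (T (i + 1) (A x))‖ :=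
          (norm_add_le _ _).trans (by gcongr; exact norm_sub_le _ _)
      _ ≤ 3 * (M / μ * ((3 * (M / μ)) ^ j * ‖x‖)) := by linarith
      _ = _ := by ring

/-- Apply the subdiagonal block of `A` to the recursion for `T i`: since `N i` is a right inverse,
the first two terms cancel and only `T (i + 1) (A x)` remains. -/
theorem row_succ_A (h : HasStaircaseForm A B g N K κ M μ) {T : ℕ → E →ₗ[ℝ] E}
    (hT' : ∀ i, i + 1 < κ → ∀ x, T i x = (g i x - g (i + 1) x)
      - N i (A (g i x - g (i + 1) x)) + N i (T (i + 1) (A x)))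
    (hrow : ∀ i, i < κ → IsBlockRow g (T i) i) {i : ℕ} (hi : i + 1 < κ) (x : E) :
    T (i + 1) (A x) = g (i + 1) (A (T i x)) - g (i + 2) (A (T i x)) := by
  have H := hrow (i + 1) hi
  have e1 := h.block_A_N i hi (A (g i x - g (i + 1) x))
  have e2 := h.block_A_N i hi (T (i + 1) (A x))
  rw [H.g_apply, H.g_succ_apply, sub_zero] at e2
  rw [hT' i hi]
  simp only [map_add, map_sub] at e1 e2 ⊢
  conv_lhs => rw [← e2]
  rw [← sub_eq_zero] at e1 ⊢
  rw [← e1]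
  abel

/-- States of a trajectory are controlled by the chain coordinates. -/
theorem norm_state_le (h : HasStaircaseForm A B g N K κ M μ) {T : ℕ → E →ₗ[ℝ] E}
    (hT : T (κ - 1) = g (κ - 1))
    (hT' : ∀ i, i + 1 < κ → ∀ x, T i x = (g i x - g (i + 1) x)
      - N i (A (g i x - g (i + 1) x)) + N i (T (i + 1) (A x)))
    (hrow : ∀ i, i < κ → IsBlockRow g (T i) i) {x : ℕ → E} {u : ℕ → P}
    (hx : ∀ k, x (k + 1) = A (x k) + B (u k)) {k₀ : ℕ} {Z : ℝ} (hZ : 0 ≤ Z)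
    (hz : ∀ i, i < κ → ∀ k, k₀ ≤ k → ‖T i (x k)‖ ≤ Z) (j : ℕ) :
    ∀ i, i + j = κ → ∀ k, k₀ ≤ k → ‖g i (x k)‖ ≤ (5 * (M / μ)) ^ j * Z := by
  have hr := h.one_le_ratio
  have hμ := h.coupling_pos
  have hM := h.one_le_bound
  induction j with
  | zero =>
    intro i hi k _
    obtain rfl : i = κ := by omega
    rw [h.g_index, norm_zero]
    positivity
  | succ j ih =>
    intro i hi k hk
    have hq : 1 ≤ (5 * (M / μ)) ^ j := one_le_pow₀ (by linarith)
    have hZq : Z ≤ (5 * (M / μ)) ^ j * Z := by nlinarith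
    by_cases hi' : i + 1 < κ
    · set w := g (i + 1) (x k) with hw
      have h1 : ‖w‖ ≤ (5 * (M / μ)) ^ j * Z := ih (i + 1) (by omega) k hk
      have h2 : ‖g (i + 1) (x (k + 1))‖ ≤ (5 * (M / μ)) ^ j * Z :=
        ih (i + 1) (by omega) (k + 1) (by omega)
      have hgB : ∀ m v, g (i + 1 + m) (B v) = 0 := by
        intro m v
        have := h.g_comp (i + 1 + m) 1 (B v)
        rwa [h.g_B, map_zero, max_eq_left (by omega), eq_comm] at this
      -- The input does not reach the tail `g (i + 1)`, so the image under `A` of block `i` is read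
      -- off from the next state, up to the contribution of the shorter tail `w`.
      have e1 : N i (A (g i (x k) - w)) = N i (g (i + 1) (x (k + 1))) - N i (A w) := by
        have b0 := h.N_block i hi' (A (g i (x k)))
        have b1 := h.N_block i hi' (x (k + 1))
        have b2 := h.N_block i hi' (g (i + 1) (x (k + 1)))
        rw [h.g_self, show g (i + 2) (g (i + 1) (x (k + 1))) = g (i + 2) (x (k + 1)) from
          h.g_succ_g (i + 1) _, b1] at b2
        have c1 : g (i + 1) (A (g i (x k))) = g (i + 1) (x (k + 1)) := by
          rw [h.g_A, hx, map_add, hgB 0, add_zero]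
        have c2 : g (i + 2) (A (g i (x k))) = g (i + 2) (x (k + 1)) := by
          rw [← h.g_succ_g (i + 1), c1, h.g_succ_g (i + 1)]
        rw [c1, c2, b1, b2] at b0
        rw [map_sub, map_sub, ← b0]
      have e2 : N i (T (i + 1) (A (x k))) = N i (A (T i (x k))) := by
        rw [h.row_succ_A hT' hrow hi', h.N_block i hi']
      -- Solve the recursion of row `i` for the tail `g i (x k)`. The five terms on the right
      -- account for the constant 5.
      have e3 : g i (x k) = w + (T i (x k) + (N i (g (i + 1) (x (k + 1))) - N i (A w))
          - N i (A (T i (x k)))) := by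
        rw [← e1, ← e2, hT' i hi', ← hw]
        abel
      have n1 := hz i (by omega) k hk
      have n2 : ‖N i (g (i + 1) (x (k + 1)))‖ ≤ M / μ * ((5 * (M / μ)) ^ j * Z) := by
        refine (h.norm_N i hi' _).trans ?_
        rw [div_mul_eq_mul_div]
        have : (5 * (M / μ)) ^ j * Z ≤ M * ((5 * (M / μ)) ^ j * Z) :=
          le_mul_of_one_le_left (by positivity) hM
        gcongr
        linarith
      have n3 : ∀ y, ‖y‖ ≤ (5 * (M / μ)) ^ j * Z →
          ‖N i (A y)‖ ≤ M / μ * ((5 * (M / μ)) ^ j * Z) := by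
        intro y hy
        refine (h.norm_N i hi' _).trans ?_
        rw [div_mul_eq_mul_div]
        gcongr
        exact (h.norm_A y).trans (by gcongr)
      have n4 := n3 w h1
      have n5 := n3 (T i (x k)) (n1.trans hZq)
      have n6 : (5 * (M / μ)) ^ j * Z ≤ M / μ * ((5 * (M / μ)) ^ j * Z) :=
        le_mul_of_one_le_left (by positivity) hr
      rw [e3]
      calc _ ≤ ‖w‖ + (‖T i (x k)‖ + (‖N i (g (i + 1) (x (k + 1)))‖ + ‖N i (A w)‖)
            + ‖N i (A (T i (x k)))‖) := by
            refine (norm_add_le _ _).trans ?_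
            gcongr
            refine (norm_sub_le _ _).trans ?_
            gcongr
            refine (norm_add_le _ _).trans ?_
            gcongr
            exact norm_sub_le _ _
        _ ≤ 5 * (M / μ * ((5 * (M / μ)) ^ j * Z)) := by linarith
        _ = _ := by ring
    · obtain rfl : i = κ - 1 := by omega
      rw [← hT]
      refine (hz (κ - 1) (by omega) k hk).trans (hZq.trans ?_)
      gcongr
      · linarith
      · omega

/-- A system in staircase form can be steered to the origin in `κ` steps with explicitly bounded
states and controls. -/
theorem exists_deadbeat (h : HasStaircaseForm A B g N K κ M μ) (x₀ : E) :
    ∃ (x : ℕ → E) (u : ℕ → P), x 0 = x₀ ∧ (∀ k, x (k + 1) = A (x k) + B (u k)) ∧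
      (∀ k, κ ≤ k → x k = 0) ∧ (∀ k, κ ≤ k → u k = 0) ∧
      (∀ k, ‖x k‖ ≤ (5 * (M / μ)) ^ κ * (M ^ κ * ((3 * (M / μ)) ^ κ * ‖x₀‖))) ∧
      (∀ k, ‖u k‖ ≤ M / μ * (3 * (M / μ)) ^ κ * ‖x k‖) := by
  have hr := h.one_le_ratio
  have hμ := h.coupling_pos
  have hM := h.one_le_bound
  have hκ := h.one_le_index
  obtain ⟨T, hT, hT'⟩ := h.exists_chain
  have hrow : ∀ i, i < κ → IsBlockRow g (T i) i := fun i hi =>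
    h.isBlockRow hT hT' (κ - 1 - i) i (by omega)
  have hnorm : ∀ i, i < κ → ∀ y, ‖T i y‖ ≤ (3 * (M / μ)) ^ κ * ‖y‖ := fun i hi y =>
    (h.norm_row_le hT hT' (κ - 1 - i) i (by omega) y).trans
      (by gcongr; exacts [by linarith, by omega])
  -- `T 0` takes values in the first block, on which `B` inverts `K`; this feedback therefore makes
  -- row 0 of every state after the initial one vanish.
  set f : E → E := fun y => A y - B (K (T 0 (A y))) with hf
  set x : ℕ → E := fun k => f^[k] x₀ with hxdef
  set u : ℕ → P := fun k => -K (T 0 (A (x k))) with hu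
  have hx0 : x 0 = x₀ := rfl
  have hx : ∀ k, x (k + 1) = A (x k) + B (u k) := by
    intro k
    simp only [hxdef, hu, Function.iterate_succ_apply', hf, map_neg]
    abel
  have hH := hrow 0 hκ
  have hBu : ∀ k, B (u k) = - T 0 (A (x k)) := by
    intro k
    rw [hu]
    simp only [map_neg, h.B_K]
    rw [show g 1 (T 0 (A (x k))) = 0 from hH.g_succ_apply _, sub_zero]
  have hz0 : ∀ k, T 0 (x (k + 1)) = 0 := by
    intro k
    have := hH.apply_block (T 0 (A (x k)))
    rw [hH.g_apply, hH.g_succ_apply, sub_zero] at this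
    rw [hx, hBu, map_add, map_neg, this, add_neg_cancel]
  have hzs : ∀ i, i + 1 < κ → ∀ k,
      T (i + 1) (x (k + 1)) = g (i + 1) (A (T i (x k))) - g (i + 2) (A (T i (x k))) := by
    intro i hi k
    have hB : g (i + 1) (B (u k)) = 0 := by
      have := h.g_comp (i + 1) 1 (B (u k))
      rwa [h.g_B, map_zero, max_eq_left (by omega), eq_comm] at this
    rw [hx, map_add, ← (hrow (i + 1) hi).apply_g (B (u k)), hB, map_zero, add_zero,
      h.row_succ_A hT' hrow hi]
  -- The chain relation either traces a coordinate back to the initial state or to row 0 after time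
  -- 0, where it vanishes; each link costs a factor `M`.
  have hz : ∀ i, i < κ → ∀ k, ‖T i (x k)‖ ≤ M ^ i * ((3 * (M / μ)) ^ κ * ‖x₀‖) := by
    intro i
    induction i with
    | zero =>
      intro hi k
      rcases k with _ | k
      · rw [pow_zero, one_mul]
        exact hnorm 0 hi _
      · rw [hz0, norm_zero]
        positivity
    | succ i ih =>
      intro hi k
      rcases k with _ | k
      · refine (hnorm _ hi _).trans ?_
        rw [hx0]
        exact le_mul_of_one_le_left (by positivity) (one_le_pow₀ hM)
      · rw [hzs i hi]
        refine (h.norm_block _ _).trans ((h.norm_A _).trans ?_)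
        rw [pow_succ', mul_assoc]
        gcongr
        exact ih (by omega) k
  have hzero : ∀ i, i < κ → ∀ k, i < k → T i (x k) = 0 := by
    intro i
    induction i with
    | zero =>
      intro _ k hk
      obtain ⟨k, rfl⟩ : ∃ l, k = l + 1 := ⟨k - 1, by omega⟩
      exact hz0 k
    | succ i ih =>
      intro hi k hk
      obtain ⟨k, rfl⟩ : ∃ l, k = l + 1 := ⟨k - 1, by omega⟩
      rw [hzs i hi, ih (by omega) k (by omega)]
      simp
  have hxκ : ∀ k, κ ≤ k → x k = 0 := by
    intro k hk
    -- From time `κ` on all chain coordinates vanish, so the state estimate with `Z = 0` forces the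
    -- state to vanish.
    have := h.norm_state_le hT hT' hrow hx (k₀ := κ) le_rfl
      (fun i hi k hk => by rw [hzero i hi k (by omega), norm_zero]) κ 0 (by omega) k hk
    rwa [h.g_zero, mul_zero, norm_le_zero_iff] at this
  refine ⟨x, u, hx0, hx, hxκ, fun k hk => by rw [hu]; simp [hxκ k hk], fun k => ?_, fun k => ?_⟩
  · have := h.norm_state_le hT hT' hrow hx (k₀ := 0)
      (Z := M ^ κ * ((3 * (M / μ)) ^ κ * ‖x₀‖)) (by positivity)
      (fun i hi k _ => (hz i hi k).trans (by gcongr)) κ 0 (by omega)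
      k (Nat.zero_le k)
    rwa [h.g_zero] at this
  · rw [hu, norm_neg]
    refine (h.norm_K _).trans ?_
    rw [div_mul_eq_mul_div, div_mul_eq_mul_div]
    gcongr
    refine (hnorm 0 hκ _).trans ?_
    have := mul_le_mul_of_nonneg_left (h.norm_A (x k))
      (show (0 : ℝ) ≤ (3 * (M / μ)) ^ κ by positivity)
    linarith

end HasStaircaseForm

/-! ### Right inverses from singular values -/

/-- A linear map whose first `dim F` singular values are at least `μ > 0` has a right inverse of
norm at most `1 / μ`. -/
theorem LinearMap.exists_rightInverse_of_le_singularValues {E F : Type*} [NormedAddCommGroup E]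
    [InnerProductSpace ℝ E] [FiniteDimensional ℝ E] [NormedAddCommGroup F] [InnerProductSpace ℝ F]
    [FiniteDimensional ℝ F] (T : E →ₗ[ℝ] F) {μ : ℝ} (hμ : 0 < μ)
    (h : ∀ i, i < Module.finrank ℝ F → μ ≤ T.singularValues i) :
    ∃ N : F →ₗ[ℝ] E, (∀ y, T (N y) = y) ∧ ∀ y, ‖N y‖ ≤ ‖y‖ / μ := by
  set d := Module.finrank ℝ F with hd
  have hdE : d ≤ Module.finrank ℝ E := by
    -- Otherwise the singular value with index `finrank ℝ E` would be both zero and at least `μ`.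
    by_contra! hlt
    have := h _ hlt
    rw [T.singularValues_of_finrank_le le_rfl] at this
    linarith
  set hS := T.isSymmetric_adjoint_comp_self
  set b := hS.eigenvectorBasis rfl with hb
  set v : Fin d → E := fun i => b (Fin.castLE hdE i) with hv
  have hvo : Orthonormal ℝ v := b.orthonormal.comp _ (Fin.castLE_injective hdE)
  -- The span of the leading `d` right singular vectors; `T` expands it by at least `μ`, hence maps
  -- it bijectively onto `F` by dimension.
  set S : (Fin d → ℝ) →ₗ[ℝ] E := Fintype.linearCombination ℝ v with hSdef
  have hlow : ∀ c, μ ^ 2 * ‖S c‖ ^ 2 ≤ ‖T (S c)‖ ^ 2 := by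
    intro c
    have e1 : ‖S c‖ ^ 2 = ∑ i : Fin d, c i ^ 2 := by
      rw [← real_inner_self_eq_norm_sq, hSdef, Fintype.linearCombination_apply, hvo.inner_sum]
      simp [pow_two]
    have e2 : ‖T (S c)‖ ^ 2 = ∑ i : Fin d, T.singularValues i ^ 2 * c i ^ 2 := by
      rw [← real_inner_self_eq_norm_sq, ← LinearMap.adjoint_inner_right]
      have : T.adjoint (T (S c)) = ∑ i : Fin d, (T.singularValues i ^ 2 * c i) • v i := by
        rw [hSdef, Fintype.linearCombination_apply, map_sum, map_sum]
        refine Finset.sum_congr rfl fun i _ => ?_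
        have := hS.apply_eigenvectorBasis rfl (Fin.castLE hdE i)
        rw [LinearMap.comp_apply] at this
        rw [map_smul, map_smul, hv, hb, this,
          T.sq_singularValues_of_lt rfl (i.2.trans_le hdE), smul_smul, mul_comm]
        rfl
      rw [this, hSdef, Fintype.linearCombination_apply, hvo.inner_sum]
      refine Finset.sum_congr rfl fun i _ => ?_
      simp
      ring
    rw [e1, e2, Finset.mul_sum]
    refine Finset.sum_le_sum fun i _ => ?_
    have := h i i.2
    gcongr
  have hinj : Function.Injective (T ∘ₗ S) := by
    rw [← LinearMap.ker_eq_bot, LinearMap.ker_eq_bot']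
    intro c hc
    have h1 := hlow c
    rw [← LinearMap.comp_apply, hc, norm_zero] at h1
    have h2 : S c = 0 := by
      have : ‖S c‖ ^ 2 ≤ 0 := by nlinarith [pow_pos hμ 2, sq_nonneg ‖S c‖]
      simpa using le_antisymm this (sq_nonneg _)
    have h3 := hvo.linearIndependent
    rw [Fintype.linearIndependent_iff] at h3
    rw [hSdef, Fintype.linearCombination_apply] at h2
    exact funext fun i => h3 c h2 i
  set L := LinearEquiv.ofInjectiveOfFinrankEq (T ∘ₗ S) hinj (by simp [hd]) with hL
  have hLs : ∀ y, T (S (L.symm y)) = y := fun y => L.apply_symm_apply y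
  refine ⟨S ∘ₗ L.symm.toLinearMap, hLs, fun y => ?_⟩
  have h1 := hlow (L.symm y)
  rw [hLs, ← mul_pow] at h1
  rw [le_div_iff₀ hμ, mul_comm]
  exact le_of_sq_le_sq h1 (norm_nonneg _)

theorem Matrix.exists_rightInverse_of_le_singularValue {m l : Type*} [Fintype m] [Fintype l]
    [DecidableEq l] (X : Matrix m l ℝ) {k : ℕ} (hk : Fintype.card m ≤ k) {μ : ℝ} (hμ : 0 < μ)
    (h : μ ≤ singularValue X k) :
    ∃ N : EuclideanSpace ℝ m →ₗ[ℝ] EuclideanSpace ℝ l,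
      (∀ y, X.toEuclideanLin (N y) = y) ∧ ∀ y, ‖N y‖ ≤ ‖y‖ / μ := by
  refine LinearMap.exists_rightInverse_of_le_singularValues _ hμ fun i hi => h.trans ?_
  rw [finrank_euclideanSpace] at hi
  exact (X.toEuclideanLin).singularValues_antitone (by omega)

/-! ### Quadratic forms and the spectral norm -/

namespace Matrix

theorem mulVec_dotProduct_eq {m l : Type*} [Fintype m] [Fintype l] (X : Matrix m l ℝ)
    (x : l → ℝ) (y : m → ℝ) : (X *ᵥ x) ⬝ᵥ y = x ⬝ᵥ (Xᵀ *ᵥ y) := by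
  rw [dotProduct_mulVec, vecMul_transpose]

theorem dotProduct_mulVec_comm_transpose {m l : Type*} [Fintype m] [Fintype l] (X : Matrix m l ℝ)
    (x : l → ℝ) (y : m → ℝ) : y ⬝ᵥ (X *ᵥ x) = x ⬝ᵥ (Xᵀ *ᵥ y) := by
  rw [dotProduct_comm, mulVec_dotProduct_eq]

theorem PosSemidef.dotProduct_mulVec_self_nonneg {m : Type*} [Fintype m] {X : Matrix m m ℝ}
    (hX : X.PosSemidef) (x : m → ℝ) : 0 ≤ x ⬝ᵥ (X *ᵥ x) := by
  simpa using hX.dotProduct_mulVec_nonneg x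

theorem PosSemidef.transpose_eq {m : Type*} [Fintype m] {X : Matrix m m ℝ}
    (hX : X.PosSemidef) : Xᵀ = X := by
  simpa using hX.isHermitian.eq

/-- Polarization: the entries of a symmetric matrix in terms of its quadratic form. -/
theorem apply_eq_of_isSymm {m : Type*} [Fintype m] [DecidableEq m] {X : Matrix m m ℝ}
    (hX : Xᵀ = X) (i j : m) :
    X i j = ((Pi.single i 1 + Pi.single j 1) ⬝ᵥ (X *ᵥ (Pi.single i 1 + Pi.single j 1))
      - Pi.single i 1 ⬝ᵥ (X *ᵥ Pi.single i 1) - Pi.single j 1 ⬝ᵥ (X *ᵥ Pi.single j 1)) / 2 := by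
  have h : X j i = X i j := by rw [← transpose_apply X, hX]
  simp [mulVec_add, add_dotProduct, h]
  ring

theorem dotProduct_self_eq_norm_sq {m : Type*} [Fintype m] (x : m → ℝ) :
    x ⬝ᵥ x = ‖WithLp.toLp 2 x‖ ^ 2 := by
  rw [EuclideanSpace.real_norm_sq_eq]
  simp [dotProduct, pow_two]

theorem dotProduct_mulVec_self_le {m : Type*} [Fintype m] [DecidableEq m] (X : Matrix m m ℝ)
    (x : m → ℝ) : x ⬝ᵥ (X *ᵥ x) ≤ ‖X‖ * ‖WithLp.toLp 2 x‖ ^ 2 := by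
  have h := real_inner_le_norm (WithLp.toLp 2 (X *ᵥ x)) (WithLp.toLp 2 x)
  rw [EuclideanSpace.inner_toLp_toLp] at h
  have h2 := X.l2_opNorm_mulVec (WithLp.toLp 2 x)
  simp only [star_trivial] at h
  refine h.trans ?_
  rw [pow_two, ← mul_assoc]
  gcongr
  exact h2

theorem l2_opNorm_le_of_forall {m l : Type*} [Fintype m] [Fintype l] [DecidableEq l]
    (X : Matrix m l ℝ) {b : ℝ} (hb : 0 ≤ b)
    (h : ∀ x : l → ℝ, ‖WithLp.toLp 2 (X *ᵥ x)‖ ≤ b * ‖WithLp.toLp 2 x‖) : ‖X‖ ≤ b := by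
  rw [l2_opNorm_def]
  exact ContinuousLinearMap.opNorm_le_bound _ hb fun x => h x.ofLp

open scoped MatrixOrder in
theorem PosSemidef.exists_eq_transpose_mul_self {m : Type*} [Fintype m] [DecidableEq m]
    {X : Matrix m m ℝ} (hX : X.PosSemidef) : ∃ S : Matrix m m ℝ, X = Sᵀ * S := by
  obtain ⟨S, hS⟩ := CStarAlgebra.nonneg_iff_eq_star_mul_self.mp hX.nonneg
  exact ⟨S, by simpa [star_eq_conjTranspose] using hS⟩

theorem dotProduct_transpose_mul_self_mulVec {m : Type*} [Fintype m] (S : Matrix m m ℝ)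
    (x : m → ℝ) : x ⬝ᵥ ((Sᵀ * S) *ᵥ x) = ‖WithLp.toLp 2 (S *ᵥ x)‖ ^ 2 := by
  rw [← mulVec_mulVec, ← mulVec_dotProduct_eq, dotProduct_self_eq_norm_sq]

/-- Factor `X = Sᵀ * S`: the form is the squared norm of `S x`, and `‖X‖ = ‖S‖ ^ 2` by the
C⋆-identity. -/
theorem PosSemidef.l2_opNorm_le {m : Type*} [Fintype m] [DecidableEq m] {X : Matrix m m ℝ}
    (hX : X.PosSemidef) {b : ℝ} (hb : 0 ≤ b)
    (h : ∀ x, x ⬝ᵥ (X *ᵥ x) ≤ b * ‖WithLp.toLp 2 x‖ ^ 2) : ‖X‖ ≤ b := by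
  obtain ⟨S, rfl⟩ := hX.exists_eq_transpose_mul_self
  have h1 : ‖S‖ ≤ √b := by
    refine S.l2_opNorm_le_of_forall (Real.sqrt_nonneg b) fun x => ?_
    have h2 := h x
    rw [dotProduct_transpose_mul_self_mulVec, ← Real.sq_sqrt hb, ← mul_pow] at h2
    exact le_of_sq_le_sq h2 (by positivity)
  rw [← conjTranspose_eq_transpose_of_trivial, l2_opNorm_conjTranspose_mul_self]
  calc ‖S‖ * ‖S‖ ≤ √b * √b := by gcongr
    _ = b := Real.mul_self_sqrt hb

theorem PosDef.exists_norm_sq_le {m : Type*} [Fintype m] [DecidableEq m] {X : Matrix m m ℝ}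
    (hX : X.PosDef) : ∃ C, 0 ≤ C ∧ ∀ x, ‖WithLp.toLp 2 x‖ ^ 2 ≤ C * (x ⬝ᵥ (X *ᵥ x)) := by
  obtain ⟨S, hS⟩ := hX.posSemidef.exists_eq_transpose_mul_self
  have hunit : IsUnit S.det := by
    have h := (isUnit_iff_isUnit_det _).mp hX.isUnit
    rw [hS, det_mul] at h
    exact isUnit_of_mul_isUnit_right h
  refine ⟨‖S⁻¹‖ ^ 2, by positivity, fun x => ?_⟩
  rw [hS, dotProduct_transpose_mul_self_mulVec, ← mul_pow]
  have h := S⁻¹.l2_opNorm_mulVec (WithLp.toLp 2 (S *ᵥ x))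
  simp only [mulVec_mulVec, nonsing_inv_mul _ hunit, one_mulVec] at h
  gcongr
  exact h

theorem _root_.ContinuousAt.matrix_mul {α m l o : Type*} [TopologicalSpace α] [Fintype l]
    {f : α → Matrix m l ℝ} {f' : α → Matrix l o ℝ} {a : α} (hf : ContinuousAt f a)
    (hf' : ContinuousAt f' a) : ContinuousAt (fun x => f x * f' x) a :=
  ContinuousAt.comp (g := fun q : Matrix m l ℝ × Matrix l o ℝ => q.1 * q.2)
    (continuous_fst.matrix_mul continuous_snd).continuousAt (hf.prodMk hf')

end Matrix

/-! ### The Riccati map as a dynamic programming operator -/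

section Riccati

open Matrix

variable {n p : ℕ} {A : Matrix (Fin n) (Fin n) ℝ} {B : Matrix (Fin n) (Fin p) ℝ}
  {Q : Matrix (Fin n) (Fin n) ℝ} {R : Matrix (Fin p) (Fin p) ℝ}

/-- The one-step cost. -/
def stageCost (Q : Matrix (Fin n) (Fin n) ℝ) (R : Matrix (Fin p) (Fin p) ℝ) (x : Fin n → ℝ)
    (u : Fin p → ℝ) : ℝ :=
  x ⬝ᵥ (Q *ᵥ x) + u ⬝ᵥ (R *ᵥ u)

/-- The optimal control of one step. -/
noncomputable def riccatiControl (A : Matrix (Fin n) (Fin n) ℝ) (B : Matrix (Fin n) (Fin p) ℝ)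
    (R : Matrix (Fin p) (Fin p) ℝ) (P : Matrix (Fin n) (Fin n) ℝ) (x : Fin n → ℝ) : Fin p → ℝ :=
  -(((Bᵀ * P * B + R)⁻¹ * Bᵀ * P * A) *ᵥ x)

theorem posDef_riccatiWeight {P : Matrix (Fin n) (Fin n) ℝ} (hP : P.PosSemidef) (hR : R.PosDef) :
    (Bᵀ * P * B + R).PosDef := by
  rw [add_comm]
  refine hR.add_posSemidef ?_
  simpa using hP.conjTranspose_mul_mul_same B

/-- Completing the square in `u`. It shows that the Riccati map computes the minimum over `u` of
stage cost plus cost-to-go, attained at `riccatiControl`. -/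
theorem riccati_completion {P : Matrix (Fin n) (Fin n) ℝ} (hP : P.PosSemidef) (hR : R.PosDef)
    (x : Fin n → ℝ) (u : Fin p → ℝ) :
    stageCost Q R x u + (A *ᵥ x + B *ᵥ u) ⬝ᵥ (P *ᵥ (A *ᵥ x + B *ᵥ u)) =
      x ⬝ᵥ (riccatiMap A B Q R P *ᵥ x) +
      (u - riccatiControl A B R P x) ⬝ᵥ
        ((Bᵀ * P * B + R) *ᵥ (u - riccatiControl A B R P x)) := by
  have hS := posDef_riccatiWeight (B := B) hP hR
  have hPt := hP.transpose_eq
  have hSt := hS.posSemidef.transpose_eq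
  set S := Bᵀ * P * B + R with hSdef
  have hunit : IsUnit S.det := (isUnit_iff_isUnit_det _).mp hS.isUnit
  have hSit : (S⁻¹)ᵀ = S⁻¹ := by rw [transpose_nonsing_inv, hSt]
  have e1 : u ⬝ᵥ (S *ᵥ u) = u ⬝ᵥ ((Bᵀ * P * B) *ᵥ u) + u ⬝ᵥ (R *ᵥ u) := by
    rw [hSdef, add_mulVec, dotProduct_add]
  have e2 : x ⬝ᵥ ((Aᵀ * P * B) *ᵥ u) = u ⬝ᵥ ((Bᵀ * P * A) *ᵥ x) := by
    rw [dotProduct_mulVec_comm_transpose]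
    simp [hPt, Matrix.mul_assoc]
  have e3 : S * (S⁻¹ * Bᵀ * P * A) = Bᵀ * P * A := by
    rw [Matrix.mul_assoc, Matrix.mul_assoc, mul_nonsing_inv_cancel_left _ _ hunit,
      Matrix.mul_assoc]
  have e4 : (S⁻¹ * Bᵀ * P * A)ᵀ * S = Aᵀ * P * B := by
    have := congrArg transpose e3
    rw [transpose_mul, hSt] at this
    rw [this]
    simp [hPt, Matrix.mul_assoc]
  have e5 : (S⁻¹ * Bᵀ * P * A)ᵀ * (Bᵀ * P * A) = Aᵀ * P * B * S⁻¹ * Bᵀ * P * A := by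
    simp [hPt, hSit, Matrix.mul_assoc]
  rw [stageCost, riccatiControl, riccatiMap, ← hSdef, sub_neg_eq_add]
  simp only [mulVec_add, add_dotProduct, dotProduct_add, mulVec_mulVec, mulVec_dotProduct_eq,
    sub_mulVec, add_mulVec, dotProduct_sub, e3, ← Matrix.mul_assoc]
  simp only [← Matrix.mul_assoc] at e4 e5
  simp only [e4, e5, e1, e2]
  ring

theorem riccati_le {P : Matrix (Fin n) (Fin n) ℝ} (hP : P.PosSemidef) (hR : R.PosDef)
    (x : Fin n → ℝ) (u : Fin p → ℝ) :
    x ⬝ᵥ (riccatiMap A B Q R P *ᵥ x) ≤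
      stageCost Q R x u + (A *ᵥ x + B *ᵥ u) ⬝ᵥ (P *ᵥ (A *ᵥ x + B *ᵥ u)) := by
  rw [riccati_completion hP hR]
  have := (posDef_riccatiWeight (B := B) hP hR).posSemidef.dotProduct_mulVec_self_nonneg
    (u - riccatiControl A B R P x)
  linarith

theorem riccati_eq {P : Matrix (Fin n) (Fin n) ℝ} (hP : P.PosSemidef) (hR : R.PosDef)
    (x : Fin n → ℝ) :
    x ⬝ᵥ (riccatiMap A B Q R P *ᵥ x) =
      stageCost Q R x (riccatiControl A B R P x) +
        (A *ᵥ x + B *ᵥ riccatiControl A B R P x) ⬝ᵥ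
          (P *ᵥ (A *ᵥ x + B *ᵥ riccatiControl A B R P x)) := by
  rw [riccati_completion hP hR]
  simp

theorem riccatiMap_transpose {P : Matrix (Fin n) (Fin n) ℝ} (hQ : Q.PosSemidef)
    (hP : P.PosSemidef) (hR : R.PosDef) :
    (riccatiMap A B Q R P)ᵀ = riccatiMap A B Q R P := by
  have hSt := (posDef_riccatiWeight (B := B) hP hR).posSemidef.transpose_eq
  have hSit : ((Bᵀ * P * B + R)⁻¹)ᵀ = (Bᵀ * P * B + R)⁻¹ := by
    rw [transpose_nonsing_inv, hSt]
  rw [riccatiMap]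
  generalize (Bᵀ * P * B + R)⁻¹ = W at *
  simp [hP.transpose_eq, hQ.transpose_eq, hSit, Matrix.mul_assoc]

theorem form_Q_le_riccati {P : Matrix (Fin n) (Fin n) ℝ} (hP : P.PosSemidef) (hR : R.PosDef)
    (x : Fin n → ℝ) : x ⬝ᵥ (Q *ᵥ x) ≤ x ⬝ᵥ (riccatiMap A B Q R P *ᵥ x) := by
  rw [riccati_eq hP hR, stageCost]
  have h1 := hR.posSemidef.dotProduct_mulVec_self_nonneg (riccatiControl A B R P x)
  have h2 := hP.dotProduct_mulVec_self_nonneg (A *ᵥ x + B *ᵥ riccatiControl A B R P x)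
  linarith

theorem posSemidef_riccatiMap {P : Matrix (Fin n) (Fin n) ℝ} (hQ : Q.PosSemidef)
    (hP : P.PosSemidef) (hR : R.PosDef) : (riccatiMap A B Q R P).PosSemidef :=
  PosSemidef.of_dotProduct_mulVec_nonneg (by simpa [IsHermitian] using riccatiMap_transpose hQ hP hR)
    fun x => by
      simpa using (hQ.dotProduct_mulVec_self_nonneg x).trans (form_Q_le_riccati hP hR x)

/-- The control optimal for `P'` is also admissible for `P`, at no larger a cost. -/
theorem riccatiMap_mono {P P' : Matrix (Fin n) (Fin n) ℝ} (hP : P.PosSemidef)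
    (hP' : P'.PosSemidef) (hR : R.PosDef) (h : ∀ x, x ⬝ᵥ (P *ᵥ x) ≤ x ⬝ᵥ (P' *ᵥ x))
    (x : Fin n → ℝ) :
    x ⬝ᵥ (riccatiMap A B Q R P *ᵥ x) ≤ x ⬝ᵥ (riccatiMap A B Q R P' *ᵥ x) := by
  rw [riccati_eq hP' hR]
  exact (riccati_le hP hR x _).trans (by gcongr; exact h _)

theorem posSemidef_iterate_riccatiMap {P : Matrix (Fin n) (Fin n) ℝ} (hQ : Q.PosSemidef)
    (hP : P.PosSemidef) (hR : R.PosDef) (t : ℕ) : ((riccatiMap A B Q R)^[t] P).PosSemidef := by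
  induction t with
  | zero => exact hP
  | succ t ih =>
    rw [Function.iterate_succ_apply']
    exact posSemidef_riccatiMap hQ ih hR

/-- The value of the Riccati iteration is at most the cost of any control sequence. -/
theorem iterate_riccatiMap_le_cost {P : Matrix (Fin n) (Fin n) ℝ} (hQ : Q.PosSemidef)
    (hP : P.PosSemidef) (hR : R.PosDef) {x : ℕ → Fin n → ℝ} {u : ℕ → Fin p → ℝ}
    (hx : ∀ k, x (k + 1) = A *ᵥ x k + B *ᵥ u k) (t : ℕ) : ∀ j,
    x j ⬝ᵥ ((riccatiMap A B Q R)^[t] P *ᵥ x j) ≤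
      ∑ k ∈ Finset.range t, stageCost Q R (x (j + k)) (u (j + k))
        + x (j + t) ⬝ᵥ (P *ᵥ x (j + t)) := by
  induction t with
  | zero => intro j; simp
  | succ t ih =>
    intro j
    rw [Function.iterate_succ_apply', Finset.sum_range_succ']
    have h1 := riccati_le (A := A) (B := B) (Q := Q)
      (posSemidef_iterate_riccatiMap (A := A) (B := B) hQ hP hR t) hR (x j) (u j)
    rw [← hx] at h1
    have h2 := ih (j + 1)
    simp only [add_assoc, add_comm 1] at h2
    simp only [add_zero]
    linarith

theorem IsRiccatiDifferenceSolution.apply_zero {T : ℕ} {P : ℕ → Matrix (Fin n) (Fin n) ℝ}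
    (h : IsRiccatiDifferenceSolution A B Q R T P) : P 0 = (riccatiMap A B Q R)^[T] Q := by
  have key : ∀ t, t ≤ T → P (T - t) = (riccatiMap A B Q R)^[t] Q := by
    intro t
    induction t with
    | zero => intro _; exact h.1
    | succ t ih =>
      intro ht
      rw [Function.iterate_succ_apply', ← ih (by omega), ← h.2 (T - t) (by omega) (by omega)]
      congr 1
  simpa using key T le_rfl

theorem continuousAt_riccatiMap {P : Matrix (Fin n) (Fin n) ℝ} (hP : P.PosSemidef)
    (hR : R.PosDef) : ContinuousAt (riccatiMap A B Q R) P := by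
  have hS := (posDef_riccatiWeight (B := B) hP hR).det_pos.ne'
  have hc : Continuous fun P : Matrix (Fin n) (Fin n) ℝ => Bᵀ * P * B + R := by fun_prop
  have hinv : ContinuousAt (fun P : Matrix (Fin n) (Fin n) ℝ => (Bᵀ * P * B + R)⁻¹) P := by
    simp only [inv_def, Ring.inverse_eq_inv']
    exact (hc.matrix_det.continuousAt.inv₀ hS).smul hc.matrix_adjugate.continuousAt
  unfold riccatiMap
  have h1 : Continuous fun P : Matrix (Fin n) (Fin n) ℝ => Aᵀ * P * A + Q := by fun_prop
  have h2 : Continuous fun P : Matrix (Fin n) (Fin n) ℝ => Aᵀ * P * B := by fun_prop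
  exact h1.continuousAt.sub ((((h2.continuousAt.matrix_mul hinv).matrix_mul
    continuousAt_const).matrix_mul continuousAt_id).matrix_mul continuousAt_const)

end Riccati

/-! ### The algebraic Riccati equation: existence and uniqueness -/

section Algebraic

open Matrix

theorem Matrix.ext_of_forms_eq {m : Type*} [Fintype m] [DecidableEq m] {X Y : Matrix m m ℝ}
    (hX : Xᵀ = X) (hY : Yᵀ = Y) (h : ∀ x, x ⬝ᵥ (X *ᵥ x) = x ⬝ᵥ (Y *ᵥ x)) : X = Y := by
  ext i j
  rw [apply_eq_of_isSymm hX, apply_eq_of_isSymm hY, h, h, h]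

/-- A monotone sequence of symmetric matrices with bounded quadratic forms converges. -/
theorem Matrix.exists_tendsto_of_monotone_forms {m : Type*} [Fintype m] [DecidableEq m]
    {V : ℕ → Matrix m m ℝ} (hV : ∀ t, (V t)ᵀ = V t)
    (hmono : ∀ x, Monotone fun t => x ⬝ᵥ (V t *ᵥ x))
    (hbdd : ∀ x, ∃ c, ∀ t, x ⬝ᵥ (V t *ᵥ x) ≤ c) : ∃ L, Tendsto V atTop (𝓝 L) := by
  have h : ∀ x, ∃ l, Tendsto (fun t => x ⬝ᵥ (V t *ᵥ x)) atTop (𝓝 l) := by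
    intro x
    obtain ⟨c, hc⟩ := hbdd x
    exact ⟨_, tendsto_atTop_ciSup (hmono x) ⟨c, by rintro _ ⟨t, rfl⟩; exact hc t⟩⟩
  choose q hq using h
  refine ⟨Matrix.of fun i j => (q (Pi.single i 1 + Pi.single j 1) - q (Pi.single i 1)
    - q (Pi.single j 1)) / 2, ?_⟩
  refine tendsto_pi_nhds.mpr fun i => tendsto_pi_nhds.mpr fun j => ?_
  have h1 : ∀ t, V t i j = _ := fun t => apply_eq_of_isSymm (hV t) i j
  simp only [h1]
  exact (((hq _).sub (hq _)).sub (hq _)).div_const 2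

variable {n p : ℕ} {A : Matrix (Fin n) (Fin n) ℝ} {B : Matrix (Fin n) (Fin p) ℝ}
  {Q : Matrix (Fin n) (Fin n) ℝ} {R : Matrix (Fin p) (Fin p) ℝ}

/-- The trajectory of the closed loop of a positive definite solution has summable costs, so that
the quadratic form of any matrix tends to zero along it; a second solution is therefore no
larger. -/
theorem form_le_of_isPosDefRiccatiSolution (hQ : Q.PosDef) (hR : R.PosDef)
    {P P' : Matrix (Fin n) (Fin n) ℝ} (hP : IsPosDefRiccatiSolution A B Q R P)
    (hP' : IsPosDefRiccatiSolution A B Q R P') (x₀ : Fin n → ℝ) :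
    x₀ ⬝ᵥ (P' *ᵥ x₀) ≤ x₀ ⬝ᵥ (P *ᵥ x₀) := by
  set x : ℕ → Fin n → ℝ := fun k => (fun y => A *ᵥ y + B *ᵥ riccatiControl A B R P y)^[k] x₀
    with hxdef
  set u : ℕ → Fin p → ℝ := fun k => riccatiControl A B R P (x k) with hu
  have hx : ∀ k, x (k + 1) = A *ᵥ x k + B *ᵥ u k := fun k => by
    simp only [hxdef, hu, Function.iterate_succ_apply']
  have hstep : ∀ k, stageCost Q R (x k) (u k) = x k ⬝ᵥ (P *ᵥ x k)
      - x (k + 1) ⬝ᵥ (P *ᵥ x (k + 1)) := by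
    intro k
    have h := riccati_eq (A := A) (B := B) (Q := Q) hP.1.posSemidef hR (x k)
    rw [← hP.2] at h
    rw [h, hx]
    ring
  have hsum : ∀ t, ∑ k ∈ Finset.range t, stageCost Q R (x k) (u k)
      = x₀ ⬝ᵥ (P *ᵥ x₀) - x t ⬝ᵥ (P *ᵥ x t) := by
    intro t
    simp only [hstep]
    exact Finset.sum_range_sub' (fun k => x k ⬝ᵥ (P *ᵥ x k)) t
  have hQc : ∀ k, x k ⬝ᵥ (Q *ᵥ x k) ≤ stageCost Q R (x k) (u k) := fun k =>
    le_add_of_nonneg_right (hR.posSemidef.dotProduct_mulVec_self_nonneg _)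
  have hsummable : Summable fun k => stageCost Q R (x k) (u k) :=
    summable_of_sum_range_le
      (fun k => (hQ.posSemidef.dotProduct_mulVec_self_nonneg _).trans (hQc k)) fun t => by
        rw [hsum]
        exact sub_le_self _ (hP.1.posSemidef.dotProduct_mulVec_self_nonneg _)
  obtain ⟨C, hC, hCx⟩ := hQ.exists_norm_sq_le
  have hP'x : ∀ k, x k ⬝ᵥ (P' *ᵥ x k) ≤ ‖P'‖ * (C * stageCost Q R (x k) (u k)) := fun k =>
    (dotProduct_mulVec_self_le P' (x k)).trans
      (mul_le_mul_of_nonneg_left ((hCx _).trans (mul_le_mul_of_nonneg_left (hQc k) hC))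
        (norm_nonneg _))
  have hfix : ∀ t, (riccatiMap A B Q R)^[t] P' = P' := fun t =>
    Function.iterate_fixed hP'.2.symm t
  -- Use the controls of `P` with terminal weight `P'`, which the Riccati map fixes. The stage costs
  -- telescope and the terminal term is dominated by one stage cost.
  have hle : ∀ t, x₀ ⬝ᵥ (P' *ᵥ x₀) ≤ x₀ ⬝ᵥ (P *ᵥ x₀)
      + ‖P'‖ * (C * stageCost Q R (x t) (u t)) := by
    intro t
    have h := iterate_riccatiMap_le_cost hQ.posSemidef hP'.1.posSemidef hR hx t 0
    simp only [hfix, zero_add, hsum] at h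
    have h1 := hP.1.posSemidef.dotProduct_mulVec_self_nonneg (x t)
    have h2 := hP'x t
    exact h.trans (by linarith)
  have hlim := ((hsummable.tendsto_atTop_zero.const_mul C).const_mul ‖P'‖).const_add
    (x₀ ⬝ᵥ (P *ᵥ x₀))
  simp only [mul_zero, add_zero] at hlim
  exact ge_of_tendsto' hlim hle

/-- Both bounds reduce to the iterates started at `Q`. They increase because the first iterate
dominates `Q` and the map is monotone; the limit inherits the bound, is fixed by continuity, and is
positive definite because it dominates `Q`. -/
theorem riccatiBoundedBy_of_form_le (hQ : Q.PosSemidef) (hR : R.PosDef) {κ : ℕ} {b : ℝ}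
    (hb : 0 ≤ b) (h : ∀ t, κ < t → ∀ x, x ⬝ᵥ ((riccatiMap A B Q R)^[t] Q *ᵥ x) ≤
      b * ‖WithLp.toLp 2 x‖ ^ 2) : RiccatiBoundedBy A B Q R κ b := by
  have hV : ∀ t, ((riccatiMap A B Q R)^[t] Q).PosSemidef :=
    posSemidef_iterate_riccatiMap hQ hQ hR
  refine ⟨fun T hT P hP => ?_, fun hQ' => ?_⟩
  · rw [hP.apply_zero]
    exact (hV T).l2_opNorm_le hb (h T hT)
  have hmono : ∀ x, Monotone fun t => x ⬝ᵥ ((riccatiMap A B Q R)^[t] Q *ᵥ x) := by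
    intro x
    refine monotone_nat_of_le_succ fun t => ?_
    induction t generalizing x with
    | zero => exact form_Q_le_riccati hQ hR x
    | succ t ih =>
      have := riccatiMap_mono (Q := Q) (A := A) (B := B) (hV t) (hV (t + 1)) hR ih x
      rwa [← Function.iterate_succ_apply' (riccatiMap A B Q R),
        ← Function.iterate_succ_apply' (riccatiMap A B Q R)] at this
  obtain ⟨P, hP⟩ := Matrix.exists_tendsto_of_monotone_forms (fun t => (hV t).transpose_eq) hmono
    -- The bound is assumed only beyond `κ`; monotonicity carries it to earlier iterates.
    fun x => ⟨b * ‖WithLp.toLp 2 x‖ ^ 2, fun t => (hmono x (by omega : t ≤ t + κ + 1)).trans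
      (h _ (by omega) x)⟩
  have hform : ∀ x, Tendsto (fun t => x ⬝ᵥ ((riccatiMap A B Q R)^[t] Q *ᵥ x)) atTop
      (𝓝 (x ⬝ᵥ (P *ᵥ x))) := by
    intro x
    have hc : Continuous fun X : Matrix (Fin n) (Fin n) ℝ => x ⬝ᵥ (X *ᵥ x) := by fun_prop
    exact (hc.tendsto P).comp hP
  have hPt : Pᵀ = P := by
    have hc : Continuous fun X : Matrix (Fin n) (Fin n) ℝ => Xᵀ := by fun_prop
    refine tendsto_nhds_unique ((hc.tendsto P).comp hP) ?_
    simpa only [Function.comp_def, (hV _).transpose_eq] using hP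
  have hQP : ∀ x, x ⬝ᵥ (Q *ᵥ x) ≤ x ⬝ᵥ (P *ᵥ x) := fun x =>
    ge_of_tendsto' (hform x) fun t => hmono x (Nat.zero_le t)
  have hPd : P.PosDef := PosDef.of_dotProduct_mulVec_pos (by simpa [IsHermitian] using hPt)
    fun {x} hx => by
      have := hQ'.dotProduct_mulVec_pos hx
      simp only [star_trivial] at this ⊢
      exact this.trans_le (hQP x)
  have hfix : P = riccatiMap A B Q R P := by
    refine tendsto_nhds_unique ((tendsto_add_atTop_iff_nat 1).mpr hP) ?_
    simpa only [Function.comp_def, ← Function.iterate_succ_apply'] using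
      (continuousAt_riccatiMap (A := A) (B := B) (Q := Q) hPd.posSemidef hR).tendsto.comp hP
  refine ⟨P, ⟨hPd, hfix⟩, fun P' hP' => ?_, hPd.posSemidef.l2_opNorm_le hb fun x => ?_⟩
  · exact Matrix.ext_of_forms_eq hP'.1.posSemidef.transpose_eq hPt fun x => le_antisymm
      (form_le_of_isPosDefRiccatiSolution hQ' hR ⟨hPd, hfix⟩ hP' x)
      (form_le_of_isPosDefRiccatiSolution hQ' hR hP' ⟨hPd, hfix⟩ x)
  · refine le_of_tendsto (hform x) ?_
    filter_upwards [eventually_gt_atTop κ] with t ht using h t ht x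

end Algebraic

/-! ### Coordinate projections -/

section CoordinateProjections

variable {ι : Type*} (S : ι → Prop)

/-- Restriction of a vector to the coordinates in `S`. -/
def coordRestrict : EuclideanSpace ℝ ι →ₗ[ℝ] EuclideanSpace ℝ {i // S i} where
  toFun x := WithLp.toLp 2 fun i => x i.1
  map_add' _ _ := rfl
  map_smul' _ _ := rfl

/-- Extension by zero of a vector on the coordinates in `S`. -/
def coordExtend [DecidablePred S] : EuclideanSpace ℝ {i // S i} →ₗ[ℝ] EuclideanSpace ℝ ι where
  toFun y := WithLp.toLp 2 fun i => if h : S i then y ⟨i, h⟩ else 0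
  map_add' x y := by ext i; by_cases h : S i <;> simp [h]
  map_smul' c y := by ext i; by_cases h : S i <;> simp [h]

/-- Projection to the coordinates in `S`. -/
def coordProj [DecidablePred S] : EuclideanSpace ℝ ι →ₗ[ℝ] EuclideanSpace ℝ ι :=
  coordExtend S ∘ₗ coordRestrict S

theorem coordRestrict_apply (x : EuclideanSpace ℝ ι) (i : {i // S i}) :
    coordRestrict S x i = x i.1 := rfl

theorem coordExtend_apply [DecidablePred S] (y : EuclideanSpace ℝ {i // S i}) (i : ι) :
    coordExtend S y i = if h : S i then y ⟨i, h⟩ else 0 := rfl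

theorem coordProj_apply [DecidablePred S] (x : EuclideanSpace ℝ ι) (i : ι) :
    coordProj S x i = if S i then x i else 0 := by
  by_cases h : S i <;> simp [coordProj, coordExtend_apply, coordRestrict_apply, h]

theorem coordProj_eq [DecidablePred S] (x : EuclideanSpace ℝ ι) :
    coordProj S x = coordExtend S (coordRestrict S x) := rfl

theorem coordRestrict_coordExtend [DecidablePred S] (y : EuclideanSpace ℝ {i // S i}) :
    coordRestrict S (coordExtend S y) = y := by
  ext i
  simp [coordExtend_apply, coordRestrict_apply, i.2]

theorem norm_coordProj_le [Fintype ι] [DecidablePred S] (x : EuclideanSpace ℝ ι) : ‖coordProj S x‖ ≤ ‖x‖ := by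
  refine le_of_sq_le_sq ?_ (norm_nonneg x)
  rw [EuclideanSpace.real_norm_sq_eq, EuclideanSpace.real_norm_sq_eq]
  refine Finset.sum_le_sum fun i _ => ?_
  rw [coordProj_apply]
  split_ifs
  · exact le_rfl
  · simpa using sq_nonneg (x i)

theorem norm_coordExtend [Fintype ι] [DecidablePred S] (y : EuclideanSpace ℝ {i // S i}) : ‖coordExtend S y‖ = ‖y‖ := by
  rw [← sq_eq_sq₀ (norm_nonneg _) (norm_nonneg _), EuclideanSpace.real_norm_sq_eq,
    EuclideanSpace.real_norm_sq_eq, ← Fintype.sum_subtype_add_sum_subtype S]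
  have h : ∀ i : {i // ¬ S i}, coordExtend S y i = 0 := fun i => by
    rw [coordExtend_apply, dif_neg i.2]
  have h' : ∀ i : {i // S i}, coordExtend S y i = y i := fun i => by
    rw [coordExtend_apply, dif_pos i.2]
  simp [h, h']

theorem norm_coordRestrict_le [Fintype ι] [DecidablePred S] (x : EuclideanSpace ℝ ι) : ‖coordRestrict S x‖ ≤ ‖x‖ := by
  rw [← norm_coordExtend S]
  exact norm_coordProj_le S x

end CoordinateProjections

theorem LinearMap.singularValues_le_of_norm_le {E F : Type*} [NormedAddCommGroup E]
    [InnerProductSpace ℝ E] [FiniteDimensional ℝ E] [NormedAddCommGroup F] [InnerProductSpace ℝ F]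
    [FiniteDimensional ℝ F] (T : E →ₗ[ℝ] F) {C : ℝ} (hC : 0 ≤ C) (h : ∀ x, ‖T x‖ ≤ C * ‖x‖)
    (i : ℕ) : T.singularValues i ≤ C := by
  by_cases hi : i < Module.finrank ℝ E
  · obtain ⟨v, hv⟩ :=
      (T.hasEigenvalue_adjoint_comp_self_sq_singularValues hi).exists_hasEigenvector
    have h1 : ‖T v‖ ^ 2 = T.singularValues i ^ 2 * ‖v‖ ^ 2 := by
      rw [← real_inner_self_eq_norm_sq, ← LinearMap.adjoint_inner_right,
        ← LinearMap.comp_apply, hv.apply_eq_smul, real_inner_smul_right,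
        real_inner_self_eq_norm_sq]
      rfl
    have h2 : ‖T v‖ ^ 2 ≤ C ^ 2 * ‖v‖ ^ 2 := by
      rw [← mul_pow]
      have := h v
      gcongr
    rw [h1] at h2
    have h3 : 0 < ‖v‖ ^ 2 := by
      have := norm_pos_iff.mpr hv.2
      positivity
    exact le_of_sq_le_sq (le_of_mul_le_mul_right h2 h3) hC
  · rwa [T.singularValues_of_finrank_le (not_lt.mp hi)]

/-! ### From robust coupling to the abstract staircase form -/

section Staircase

open Matrix

variable {n p : ℕ} {A : Matrix (Fin n) (Fin n) ℝ} {B : Matrix (Fin n) (Fin p) ℝ}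

theorem Matrix.norm_toLp_mulVec_of_transpose_mul_self {m : Type*} [Fintype m] [DecidableEq m]
    {U : Matrix m m ℝ} (hU : Uᵀ * U = 1) (x : m → ℝ) :
    ‖WithLp.toLp 2 (U *ᵥ x)‖ = ‖WithLp.toLp 2 x‖ := by
  rw [← sq_eq_sq₀ (norm_nonneg _) (norm_nonneg _), ← dotProduct_transpose_mul_self_mulVec, hU,
    one_mulVec, dotProduct_self_eq_norm_sq]

variable (A B) in
theorem ctrbRank_zero : ctrbRank A B 0 = 0 := by
  have := (controllabilityMatrix A B 0).rank_le_card_width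
  simpa [ctrbRank] using this

variable (A B) in
theorem ctrbRank_le (k : ℕ) : ctrbRank A B k ≤ n := by
  simpa [ctrbRank] using (controllabilityMatrix A B k).rank_le_card_height

variable (A B) in
theorem ctrbRank_one_le : ctrbRank A B 1 ≤ p := by
  have := (controllabilityMatrix A B 1).rank_le_card_width
  simpa [ctrbRank] using this

variable (A B) in
theorem ctrbRank_mono : Monotone (ctrbRank A B) := by
  refine monotone_nat_of_le_succ fun k => ?_
  rw [ctrbRank, ctrbRank, rank_eq_finrank_span_cols, rank_eq_finrank_span_cols]
  refine Submodule.finrank_mono (Submodule.span_mono ?_)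
  rintro _ ⟨⟨j, c⟩, rfl⟩
  exact ⟨⟨j.castSucc, c⟩, by ext i; simp [controllabilityMatrix, Matrix.col]⟩

theorem controllabilityIndex_spec (h : IsControllablePair A B) :
    1 ≤ controllabilityIndex A B ∧ ctrbRank A B (controllabilityIndex A B) = n := by
  refine Nat.sInf_mem (s := {k | 1 ≤ k ∧ ctrbRank A B k = n}) ?_
  obtain ⟨k, _, hk⟩ := h
  exact ⟨k + 1, by omega, le_antisymm (ctrbRank_le A B _)
    (hk.symm.le.trans (ctrbRank_mono A B (Nat.le_succ k)))⟩

theorem exists_inStairBlock (h : IsControllablePair A B) (r : Fin n) :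
    ∃ i, 1 ≤ i ∧ InStairBlock A B i r := by
  have hex : ∃ k, (r : ℕ) < ctrbRank A B k :=
    ⟨_, by rw [(controllabilityIndex_spec h).2]; exact r.2⟩
  classical
  have h0 : Nat.find hex ≠ 0 := fun h0 => by
    have := Nat.find_spec hex
    rw [h0, ctrbRank_zero] at this
    omega
  exact ⟨Nat.find hex, by omega, not_lt.mp (Nat.find_min hex (by omega)), Nat.find_spec hex⟩

theorem card_stairBlock_le (i : ℕ) :
    Fintype.card {r : Fin n // InStairBlock A B i r} ≤ stairSize A B i := by
  rw [← Fintype.card_fin (stairSize A B i)]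
  refine Fintype.card_le_of_injective
    (fun r => ⟨(r.1 : ℕ) - ctrbRank A B (i - 1), ?_⟩) ?_
  · have := r.2
    rw [stairSize]
    omega
  · intro r s h
    have hr := r.2
    have hs := s.2
    simp only [Fin.mk.injEq] at h
    exact Subtype.ext (Fin.ext (by omega))

theorem IsStaircaseTransform.lower_eq_zero (hc : IsControllablePair A B)
    {U : Matrix (Fin n) (Fin n) ℝ} (hU : IsStaircaseTransform A B U) {i : ℕ} {r s : Fin n}
    (hr : ctrbRank A B (i + 1) ≤ r) (hs : (s : ℕ) < ctrbRank A B i) :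
    (Uᵀ * A * U) r s = 0 := by
  obtain ⟨I, hI, hIr⟩ := exists_inStairBlock hc r
  obtain ⟨J, hJ, hJs⟩ := exists_inStairBlock hc s
  have h1 : i + 1 < I := by
    by_contra! hle
    have := ctrbRank_mono A B hle
    have := hIr.2
    omega
  have h2 : J ≤ i := by
    by_contra! hlt
    have := ctrbRank_mono A B (show i ≤ J - 1 by omega)
    have := hJs.1
    omega
  exact congrFun (congrFun (hU.lowerBlocks I J (by omega)) ⟨r, hIr⟩) ⟨s, hJs⟩

theorem IsStaircaseTransform.input_eq_zero (hc : IsControllablePair A B)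
    {U : Matrix (Fin n) (Fin n) ℝ} (hU : IsStaircaseTransform A B U) {r : Fin n}
    (hr : ctrbRank A B 1 ≤ r) (s : Fin p) : (Uᵀ * B) r s = 0 := by
  obtain ⟨I, hI, hIr⟩ := exists_inStairBlock hc r
  have h1 : 1 < I := by
    by_contra! hle
    have := ctrbRank_mono A B hle
    have := hIr.2
    omega
  exact congrFun (congrFun (hU.inputBlocks I h1) ⟨r, hIr⟩) s

theorem toEuclideanLin_stairBlockA (U : Matrix (Fin n) (Fin n) ℝ) (i j : ℕ)
    (y : EuclideanSpace ℝ {r : Fin n // InStairBlock A B j r}) :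
    (stairBlockA A B U i j).toEuclideanLin y = coordRestrict (InStairBlock A B i)
      ((Uᵀ * A * U).toEuclideanLin (coordExtend (InStairBlock A B j) y)) := by
  ext r
  simp only [coordRestrict_apply, Matrix.toLpLin_apply, mulVec, dotProduct]
  rw [← Fintype.sum_subtype_add_sum_subtype (InStairBlock A B j)]
  have h : ∀ s : {s // ¬ InStairBlock A B j s}, coordExtend (InStairBlock A B j) y s = 0 :=
    fun s => by rw [coordExtend_apply, dif_neg s.2]
  have h' : ∀ s : {s // InStairBlock A B j s}, coordExtend (InStairBlock A B j) y s = y s :=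
    fun s => by rw [coordExtend_apply, dif_pos s.2]
  simp only [h, h', mul_zero, Finset.sum_const_zero, add_zero]
  rfl

theorem toEuclideanLin_stairBlockB (U : Matrix (Fin n) (Fin n) ℝ) (i : ℕ)
    (y : EuclideanSpace ℝ (Fin p)) :
    (stairBlockB A B U i).toEuclideanLin y = coordRestrict (InStairBlock A B i)
      ((Uᵀ * B).toEuclideanLin y) := rfl

/-- The span of the blocks after the `i`-th one. -/
noncomputable abbrev stairTail (A : Matrix (Fin n) (Fin n) ℝ) (B : Matrix (Fin n) (Fin p) ℝ) (i : ℕ) :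
    EuclideanSpace ℝ (Fin n) →ₗ[ℝ] EuclideanSpace ℝ (Fin n) :=
  coordProj fun r : Fin n => ctrbRank A B i ≤ r

theorem stairTail_sub (i : ℕ) (x : EuclideanSpace ℝ (Fin n)) :
    stairTail A B i x - stairTail A B (i + 1) x = coordProj (InStairBlock A B (i + 1)) x := by
  ext r
  have := ctrbRank_mono A B (show i ≤ i + 1 by omega)
  simp only [PiLp.sub_apply, coordProj_apply, InStairBlock, Nat.add_sub_cancel]
  split_ifs <;> first | omega | simp

/-- Conjugation by the orthogonal `U` preserves norms, so the bound `M` survives; the maps `N` and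
`K` are the right inverses of the subdiagonal and input blocks, extended by zero. -/
theorem IsRobustlyCoupled.exists_hasStaircaseForm {M μ : ℝ} (hM : 1 ≤ M) (hA : ‖A‖ ≤ M)
    (hB : ‖B‖ ≤ M) (h : IsRobustlyCoupled A B μ) :
    ∃ U : Matrix (Fin n) (Fin n) ℝ, Uᵀ * U = 1 ∧ U * Uᵀ = 1 ∧ ∃ N K,
      HasStaircaseForm (Uᵀ * A * U).toEuclideanLin (Uᵀ * B).toEuclideanLin (stairTail A B) N K
        (controllabilityIndex A B) M μ := by
  obtain ⟨hμ, hc, U, hU, hσB, hσA⟩ := h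
  obtain ⟨hκ, hκn⟩ := controllabilityIndex_spec hc
  have hU1 : Uᵀ * U = 1 := by
    simpa [star_eq_conjTranspose] using (Matrix.mem_orthogonalGroup_iff' _ _).mp hU.orthogonal
  have hU2 : U * Uᵀ = 1 := by
    simpa [star_eq_conjTranspose] using (Matrix.mem_orthogonalGroup_iff _ _).mp hU.orthogonal
  have hnU := Matrix.norm_toLp_mulVec_of_transpose_mul_self hU1
  have hnU' := Matrix.norm_toLp_mulVec_of_transpose_mul_self (U := Uᵀ) (by simpa using hU2)
  have hM0 : 0 ≤ M := zero_le_one.trans hM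
  have hnA : ∀ x, ‖(Uᵀ * A * U).toEuclideanLin x‖ ≤ M * ‖x‖ := by
    intro x
    have h1 : (Uᵀ * A * U).toEuclideanLin x = WithLp.toLp 2 (Uᵀ *ᵥ (A *ᵥ (U *ᵥ x.ofLp))) := by
      simp [Matrix.toLpLin_apply, mulVec_mulVec, Matrix.mul_assoc]
    rw [h1, hnU']
    refine (A.l2_opNorm_mulVec (WithLp.toLp 2 (U *ᵥ x.ofLp))).trans ?_
    rw [hnU]
    gcongr
  have hnB : ∀ x, ‖(Uᵀ * B).toEuclideanLin x‖ ≤ M * ‖x‖ := by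
    intro x
    have h1 : (Uᵀ * B).toEuclideanLin x = WithLp.toLp 2 (Uᵀ *ᵥ (B *ᵥ x.ofLp)) := by
      simp [Matrix.toLpLin_apply, mulVec_mulVec]
    rw [h1, hnU']
    refine (B.l2_opNorm_mulVec x).trans ?_
    gcongr
  have hμM : μ ≤ M := by
    refine hσB.trans (LinearMap.singularValues_le_of_norm_le _ hM0 (fun x => ?_) _)
    rw [toEuclideanLin_stairBlockB]
    exact (norm_coordRestrict_le _ _).trans (hnB x)
  have hN : ∀ i, ∃ N : EuclideanSpace ℝ {r : Fin n // InStairBlock A B (i + 1 + 1) r} →ₗ[ℝ]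
      EuclideanSpace ℝ {r : Fin n // InStairBlock A B (i + 1) r},
      i + 1 < controllabilityIndex A B →
      (∀ y, (stairBlockA A B U (i + 1 + 1) (i + 1)).toEuclideanLin (N y) = y) ∧
        ∀ y, ‖N y‖ ≤ ‖y‖ / μ := by
    intro i
    by_cases hi : i + 1 < controllabilityIndex A B
    · obtain ⟨N, hN⟩ := Matrix.exists_rightInverse_of_le_singularValue
        (stairBlockA A B U (i + 1 + 1) (i + 1)) (card_stairBlock_le _) hμ
        (hσA (i + 1) (by omega) (by omega))
      exact ⟨N, fun _ => hN⟩
    · exact ⟨0, fun h => absurd h hi⟩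
  choose N hN using hN
  -- `B_1` has at most `p` rows because the first controllability matrix has `p` columns, so `σ_p`
  -- bounds all the relevant singular values from below.
  obtain ⟨K, hK, hKn⟩ := Matrix.exists_rightInverse_of_le_singularValue (stairBlockB A B U 1)
    ((card_stairBlock_le 1).trans
      ((Nat.sub_le _ _).trans (ctrbRank_one_le A B))) hμ hσB
  have hgB : ∀ u, stairTail A B 1 ((Uᵀ * B).toEuclideanLin u) = 0 := by
    intro u
    ext r
    rw [coordProj_apply]
    split_ifs with hr
    · simp only [Matrix.toLpLin_apply, mulVec, dotProduct]
      exact Finset.sum_eq_zero fun s _ => by rw [hU.input_eq_zero hc hr, zero_mul]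
    · rfl
  have hg0 : ∀ x, stairTail A B 0 x = x := by
    intro x
    ext r
    rw [coordProj_apply, ctrbRank_zero, if_pos (Nat.zero_le _)]
  refine ⟨U, hU1, hU2,
    fun i => coordExtend (InStairBlock A B (i + 1)) ∘ₗ N i ∘ₗ
      coordRestrict (InStairBlock A B (i + 1 + 1)),
    K ∘ₗ coordRestrict (InStairBlock A B 1), ?_⟩
  exact
    { one_le_index := hκ
      one_le_bound := hM
      coupling_pos := hμ
      coupling_le := hμM
      norm_A := hnA
      norm_g := fun i x => norm_coordProj_le _ x
      norm_block := fun i x => by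
        rw [stairTail_sub]
        exact norm_coordProj_le _ x
      g_comp := fun i j x => by
        ext r
        simp only [coordProj_apply, (ctrbRank_mono A B).map_max, max_le_iff]
        split_ifs <;> first | rfl | omega
      g_zero := hg0
      g_index := fun x => by
        ext r
        rw [coordProj_apply, hκn, if_neg (by omega)]
        rfl
      g_A := fun i x => by
        ext r
        simp only [coordProj_apply]
        split_ifs with hr
        · simp only [Matrix.toLpLin_apply, mulVec, dotProduct]
          refine Finset.sum_congr rfl fun s _ => ?_
          rw [coordProj_apply]
          split_ifs with hs
          · rfl
          · rw [hU.lower_eq_zero hc hr (not_le.mp hs), zero_mul, zero_mul]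
        · rfl
      g_B := hgB
      norm_N := fun i hi y => by
        rw [LinearMap.comp_apply, norm_coordExtend]
        refine ((hN i hi).2 _).trans ?_
        gcongr
        exact norm_coordRestrict_le _ y
      g_N := fun i hi y => by
        ext r
        rw [coordProj_apply, LinearMap.comp_apply, coordExtend_apply]
        split_ifs with h1 h2 h2
        · rfl
        · rfl
        · exact absurd h2.1 h1
        · rfl
      g_succ_N := fun i hi y => by
        ext r
        rw [coordProj_apply, LinearMap.comp_apply, coordExtend_apply]
        split_ifs with h1 h2
        · exact absurd h2.2 (not_lt.mpr h1)
        · rfl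
        · rfl
      N_block := fun i hi y => by
        rw [stairTail_sub]
        simp only [LinearMap.comp_apply, coordProj_eq, coordRestrict_coordExtend]
      block_A_N := fun i hi y => by
        rw [stairTail_sub, stairTail_sub, coordProj_eq, LinearMap.comp_apply,
          ← toEuclideanLin_stairBlockA, LinearMap.comp_apply, (hN i hi).1, coordProj_eq]
      norm_K := fun y => by
        refine (hKn _).trans ?_
        gcongr
        exact norm_coordRestrict_le _ y
      B_K := fun y => by
        have h1 := stairTail_sub (A := A) (B := B) 0
          ((Uᵀ * B).toEuclideanLin (K (coordRestrict (InStairBlock A B 1) y)))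
        have h2 := stairTail_sub (A := A) (B := B) 0 y
        rw [zero_add, hgB, sub_zero, hg0, coordProj_eq, ← toEuclideanLin_stairBlockB, hK] at h1
        rw [zero_add, hg0] at h2
        rw [LinearMap.comp_apply, h1, h2, coordProj_eq] }

end Staircase

/-! ### Cost of deadbeat control and the polynomial bound -/

section Bounds

open Matrix

variable {n p : ℕ} {A : Matrix (Fin n) (Fin n) ℝ} {B : Matrix (Fin n) (Fin p) ℝ}
  {Q : Matrix (Fin n) (Fin n) ℝ} {R : Matrix (Fin p) (Fin p) ℝ}

theorem IsRobustlyCoupled.one_le_ratio {M μ : ℝ} (hM : 1 ≤ M) (hA : ‖A‖ ≤ M) (hB : ‖B‖ ≤ M)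
    (h : IsRobustlyCoupled A B μ) : 1 ≤ M / μ := by
  obtain ⟨U, -, -, N, K, hS⟩ := h.exists_hasStaircaseForm hM hA hB
  exact hS.one_le_ratio

/-- A robustly coupled pair can be steered to the origin in `κ` steps, the states and controls
growing at most exponentially in `κ`. -/
theorem IsRobustlyCoupled.exists_deadbeat {M μ : ℝ} (hM : 1 ≤ M) (hA : ‖A‖ ≤ M) (hB : ‖B‖ ≤ M)
    (h : IsRobustlyCoupled A B μ) (x₀ : Fin n → ℝ) :
    ∃ (x : ℕ → Fin n → ℝ) (u : ℕ → Fin p → ℝ), x 0 = x₀ ∧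
      (∀ k, x (k + 1) = A *ᵥ x k + B *ᵥ u k) ∧
      (∀ k, controllabilityIndex A B ≤ k → x k = 0) ∧
      (∀ k, controllabilityIndex A B ≤ k → u k = 0) ∧
      (∀ k, ‖WithLp.toLp 2 (x k)‖ ≤ 45 ^ controllabilityIndex A B *
        ((M / μ) ^ controllabilityIndex A B) ^ 4 * M ^ controllabilityIndex A B *
          ‖WithLp.toLp 2 x₀‖) ∧
      (∀ k, ‖WithLp.toLp 2 (u k)‖ ≤ 45 ^ controllabilityIndex A B *
        ((M / μ) ^ controllabilityIndex A B) ^ 4 * M ^ controllabilityIndex A B *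
          ‖WithLp.toLp 2 x₀‖) := by
  obtain ⟨U, hU1, hU2, N, K, hS⟩ := h.exists_hasStaircaseForm hM hA hB
  have hr := hS.one_le_ratio
  have hκ := hS.one_le_index
  obtain ⟨x, u, hx0, hx, hxκ, huκ, hxn, hun⟩ := hS.exists_deadbeat (WithLp.toLp 2 (Uᵀ *ᵥ x₀))
  set κ := controllabilityIndex A B
  have hnU := Matrix.norm_toLp_mulVec_of_transpose_mul_self hU1
  have hnU' := Matrix.norm_toLp_mulVec_of_transpose_mul_self (U := Uᵀ) (by simpa using hU2)
  rw [hnU'] at hxn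
  generalize M / μ = r at *
  have hrκ : 1 ≤ r ^ κ := one_le_pow₀ hr
  -- The input bound carries one extra factor `r`, absorbed into `r ^ κ` because `κ ≥ 1`.
  have hrr : r ≤ r ^ κ := le_self_pow₀ hr (by omega)
  set s := ‖WithLp.toLp 2 x₀‖
  have hs : 0 ≤ s := norm_nonneg _
  have hM0 : 0 ≤ M := zero_le_one.trans hM
  have hb1 : (5 * r) ^ κ * (M ^ κ * ((3 * r) ^ κ * s)) = 15 ^ κ * (r ^ κ) ^ 2 * M ^ κ * s := by
    rw [mul_pow, mul_pow, show (15 : ℝ) = 5 * 3 by norm_num, mul_pow]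
    ring
  refine ⟨fun k => U *ᵥ (x k).ofLp, fun k => (u k).ofLp, ?_, fun k => ?_, fun k hk => ?_,
    fun k hk => ?_, fun k => ?_, fun k => ?_⟩
  · simp only [hx0, mulVec_mulVec, hU2, one_mulVec]
  · simp only [hx, WithLp.ofLp_add, Matrix.ofLp_toLpLin, Matrix.toLin'_apply, mulVec_add,
      mulVec_mulVec, ← Matrix.mul_assoc, hU2, Matrix.one_mul]
  · simp [hxκ k hk]
  · simp [huκ k hk]
  · rw [hnU]
    refine (hxn k).trans ?_
    rw [hb1]
    gcongr
    · norm_num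
    · norm_num
  · refine (hun k).trans ?_
    calc r * (3 * r) ^ κ * ‖x k‖ ≤ r ^ κ * (3 * r) ^ κ * (15 ^ κ * (r ^ κ) ^ 2 * M ^ κ * s) := by
          have := hxn k
          rw [hb1] at this
          gcongr
      _ = _ := by
          rw [mul_pow, show (45 : ℝ) = 3 * 15 by norm_num, mul_pow]
          ring

theorem RiccatiBoundedBy.mono {κ : ℕ} {b b' : ℝ} (h : RiccatiBoundedBy A B Q R κ b)
    (hb : b ≤ b') : RiccatiBoundedBy A B Q R κ b' :=
  ⟨fun T hT P hP => (h.1 T hT P hP).trans hb, fun hQ =>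
    let ⟨P, hP, huniq, hn⟩ := h.2 hQ
    ⟨P, hP, huniq, hn.trans hb⟩⟩

theorem IsRobustlyCoupled.riccatiBoundedBy {M μ : ℝ} (hM : 1 ≤ M) (hA : ‖A‖ ≤ M) (hB : ‖B‖ ≤ M)
    (h : IsRobustlyCoupled A B μ) (hQ : Q.PosSemidef) (hR : R.PosDef) {κ : ℕ}
    (hκ : κ = controllabilityIndex A B) :
    RiccatiBoundedBy A B Q R κ
      (κ * ((‖Q‖ + ‖R‖) * (45 ^ κ * ((M / μ) ^ κ) ^ 4 * M ^ κ) ^ 2)) := by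
  subst hκ
  refine riccatiBoundedBy_of_form_le hQ hR (by positivity) fun t ht x₀ => ?_
  obtain ⟨x, u, hx0, hx, hxκ, huκ, hxn, hun⟩ := h.exists_deadbeat hM hA hB x₀
  set κ := controllabilityIndex A B
  set W := 45 ^ κ * ((M / μ) ^ κ) ^ 4 * M ^ κ
  have hcost : ∀ k, stageCost Q R (x k) (u k) ≤
      (‖Q‖ + ‖R‖) * (W ^ 2 * ‖WithLp.toLp 2 x₀‖ ^ 2) := by
    intro k
    rw [add_mul, ← mul_pow]
    have h1 := hxn k
    have h2 := hun k
    refine add_le_add ((dotProduct_mulVec_self_le Q _).trans ?_)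
      ((dotProduct_mulVec_self_le R _).trans ?_) <;> gcongr
  -- Only the first `κ` stages cost anything, which makes the bound independent of the horizon `t`.
  have hzero : ∀ k ∈ Finset.range t, k ∉ Finset.range κ → stageCost Q R (x k) (u k) = 0 := by
    intro k _ hk
    have hk : κ ≤ k := by simpa using hk
    simp [stageCost, hxκ k hk, huκ k hk]
  have hle := iterate_riccatiMap_le_cost hQ hQ hR hx t 0
  simp only [zero_add, hx0, hxκ t ht.le, zero_dotProduct, add_zero] at hle
  rw [← Finset.sum_subset (Finset.range_subset_range.mpr ht.le) hzero] at hle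
  refine hle.trans ((Finset.sum_le_card_nsmul _ _ _ fun k _ => hcost k).trans (le_of_eq ?_))
  rw [Finset.card_range, nsmul_eq_mul]
  ring

end Bounds

theorem mainTheorem7 (c : ℝ) (hc : 1 < c) :
    ∃ F : MvPolynomial (Fin 5) ℝ,
      ∀ (n p : ℕ) (A : Matrix (Fin n) (Fin n) ℝ) (B : Matrix (Fin n) (Fin p) ℝ)
        (Q : Matrix (Fin n) (Fin n) ℝ) (R : Matrix (Fin p) (Fin p) ℝ) (M μ : ℝ) (κ : ℕ),
        1 ≤ M → ‖A‖ ≤ M → ‖B‖ ≤ M →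
        IsControllablePair A B → κ = controllabilityIndex A B → IsRobustlyCoupled A B μ →
        Q.PosSemidef → R.PosDef →
        (c ≤ max M (M / μ) →
          RiccatiBoundedBy A B Q R κ
            (MvPolynomial.eval ![(M / μ) ^ κ, M ^ κ, (κ : ℝ), ‖Q‖, ‖R‖] F)) ∧
        RiccatiBoundedBy A B Q R κ
          (MvPolynomial.eval ![(c * M / μ) ^ κ, M ^ κ, (κ : ℝ), ‖Q‖, ‖R‖] F) := by
  -- `2025 = 45 ^ 2` is the base of the exponential constant in the squared deadbeat bound; `m`
  -- depends only on `c`.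
  obtain ⟨m, hm⟩ := pow_unbounded_of_one_lt 2025 hc
  refine ⟨MvPolynomial.X 2 * ((MvPolynomial.X 3 + MvPolynomial.X 4) *
    (MvPolynomial.X 0 ^ (8 + m) * MvPolynomial.X 1 ^ (2 + m))), ?_⟩
  intro n p A B Q R M μ κ hM hA hB _ hκ h hQ hR
  have hbound := h.riccatiBoundedBy hM hA hB hQ hR hκ
  have hr := h.one_le_ratio hM hA hB
  rw [mul_div_assoc]
  generalize M / μ = r at *
  have hc0 : 0 < c := zero_lt_one.trans hc
  have hrκ : 1 ≤ r ^ κ := one_le_pow₀ hr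
  have hMκ : 1 ≤ M ^ κ := one_le_pow₀ hM
  have hcκ : 1 ≤ c ^ κ := one_le_pow₀ hc.le
  have hconst : (45 ^ κ * (r ^ κ) ^ 4 * M ^ κ) ^ 2 ≤
      (c ^ κ) ^ m * ((r ^ κ) ^ 8 * (M ^ κ) ^ 2) := by
    have h1 : (2025 : ℝ) ^ κ ≤ (c ^ κ) ^ m := by
      rw [← pow_mul, mul_comm, pow_mul]
      gcongr
    calc (45 ^ κ * (r ^ κ) ^ 4 * M ^ κ) ^ 2 = 2025 ^ κ * ((r ^ κ) ^ 8 * (M ^ κ) ^ 2) := by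
          rw [show (2025 : ℝ) = 45 ^ 2 by norm_num, ← pow_mul 45 2 κ, mul_comm 2 κ, pow_mul]
          ring
      _ ≤ _ := by gcongr
  refine ⟨fun hmax => hbound.mono ?_, hbound.mono ?_⟩
  · simp only [map_mul, map_add, map_pow, MvPolynomial.eval_X]
    simp only [Matrix.cons_val]
    gcongr
    -- Both `r` and `M` are at least 1, so their product dominates the maximum; the `m` extra powers
    -- of each variable then pay for the constant.
    have h2 : c ^ κ ≤ r ^ κ * M ^ κ := by
      rcases le_max_iff.mp hmax with h' | h'
      · exact (pow_le_pow_left₀ hc0.le h' κ).trans (le_mul_of_one_le_left (by positivity) hrκ)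
      · exact (pow_le_pow_left₀ hc0.le h' κ).trans (le_mul_of_one_le_right (by positivity) hMκ)
    calc _ ≤ (c ^ κ) ^ m * ((r ^ κ) ^ 8 * (M ^ κ) ^ 2) := hconst
      _ ≤ (r ^ κ * M ^ κ) ^ m * ((r ^ κ) ^ 8 * (M ^ κ) ^ 2) := by gcongr
      _ = _ := by ring
  · simp only [map_mul, map_add, map_pow, MvPolynomial.eval_X]
    simp only [Matrix.cons_val]
    gcongr
    rw [mul_pow c r κ]
    calc _ ≤ (c ^ κ) ^ m * ((r ^ κ) ^ 8 * (M ^ κ) ^ 2) := hconst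
      -- Here the factor `c ^ κ` is part of the first variable, which already supplies more than the
      -- required `m` powers.
      _ ≤ (c ^ κ) ^ (8 + m) * ((r ^ κ) ^ (8 + m) * (M ^ κ) ^ (2 + m)) := by
          gcongr <;> first | assumption | omega
      _ = _ := by rw [mul_pow (c ^ κ), mul_assoc]
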